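/- **Conventions.** A diffeological space is a set with a specified collection of plots (functions from open subsets of Euclidean spaces) that contains all constant maps, is closed under precomposition with smooth maps, and satisfies the sheaf condition; a map is smooth if it sends plots to plots. Euclidean spaces carry their standard diffeology, subsets carry the sub-diffeology, products the product diffeology, and $C^\infty(Y,X)$ the functional diffeology (a map $U\to C^\infty(Y,X)$ is a plot iff the associated map $U\times Y\to X$ is smooth). For a diffeological space $Z$, $\pi_0^D(Z)$ is the set of equivalence classes of points of $Z$ under the relation: $z\simeq z'$ iff there is a smooth map $f:\mathbb R\to Z$ with $f(0)=z$ and $f(1)=z'$. A pair $(A,B)$ is a diffeological space $A$ with a subspace $B$; $C^\infty((A,B),(X,Y))\subseteq C^\infty(A,X)$ is the space of smooth maps sending $B$ into $Y$, with the sub-diffeology; $[(A,B),(X,Y)]:=\pi_0^D\big(C^\infty((A,B),(X,Y))\big)$, and two such maps are smoothly homotopic if they have the same class. Two pairs are smoothly homotopy equivalent if there are maps of pairs in both directions whose two composites are smoothly homotopic to the identity maps. For a pointed diffeological space $(X,x)$, write $(X,x)$ also for the pair $(X,\{x\})$ and put $\Omega(X,x)=C^\infty((\mathbb R,\{0,1\}),(X,x))$,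 pointed by the constant loop, $\Omega^0(X,x)=(X,x)$, $\Omega^n(X,x)=\Omega(\Omega^{n-1}(X,x))$ for $n\ge 1$, and $\pi_n^D(X,x)=\pi_0^D(\Omega^n(X,x))$. **Theorem.** Let $n\ge 0$ be an integer. For each pair $(A,B)$ listed below there are bijections $$[(A,B),(X,x)]\;\cong\;\pi_n^D(X,x),$$ one for every pointed diffeological space $(X,x)$, that are natural in $(X,x)$ with respect to pointed smooth maps. In items 2, 4, 6 and 8, $\epsilon$ is a fixed real number in the indicated range; it may differ from item to item. 1. $(\mathbb R^n,\partial\mathbb R^n)$, where $\partial\mathbb R^n=\{x\in\mathbb R^n \mid x_i=0\text{ or }x_i=1\text{ for some }i\}$; 2. $(\mathbb R^n,\partial_\epsilon\mathbb R^n)$, where $\partial_\epsilon\mathbb R^n=\{x\in\mathbb R^n \mid x_i\le\epsilon\text{ or }x_i\ge 1-\epsilon\text{ for some }i\}$ and $\epsilon\in(0,1/2)$; 3. $(I^n,\partial I^n)$, where $I^n=[0,1]^n\subset\mathbb R^n$ and $\partial I^n=\{x\in I^n\mid x_i=0\text{ or }x_i=1\text{ for some }i\}$; 4. $(I^n,\partial_\epsilon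 I^n)$, where $\partial_\epsilon I^n=\{x\in I^n\mid x_i\le\epsilon\text{ or }x_i\ge 1-\epsilon\text{ for some }i\}$ and $\epsilon\in(0,1/2)$; 5. $(\mathbb A^n,\partial\mathbb A^n)$, where $\mathbb A^n=\{(x_0,\dots,x_n)\in\mathbb R^{n+1}\mid\sum_i x_i=1\}$ and $\partial\mathbb A^n=\{x\in\mathbb A^n\mid x_i=0\text{ for some }i\}$; 6. $(\mathbb A^n,\partial_\epsilon\mathbb A^n)$, where $\partial_\epsilon\mathbb A^n=\{x\in\mathbb A^n\mid x_i\le\epsilon\text{ for some }i\}$ and $\epsilon\in(0,1/(n+1))$; 7. $(D^n,\partial D^n)$, where $D^n=\{x\in\mathbb R^n\mid\|x\|\le1\}$ and $\partial D^n=\{x\in D^n\mid\|x\|=1\}$; 8. $(D^n,\partial_\epsilon D^n)$, where $\partial_\epsilon D^n=\{x\in D^n\mid\|x\|>1-\epsilon\}$ and $\epsilon\in(0,1/2)$; 9. $(S^n,\{N\})$, where $S^n=\{x\in\mathbb R^{n+1}\mid\|x\|=1\}$ and $N=(0,\dots,0,1)$. Moreover, any two of the pairs 1 through 8 are smoothly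 homotopy equivalent. -/

import Mathlib

open Diffeology
open scoped ContDiff

universe u

noncomputable section

namespace SmoothHomotopy

/-! Diffeological spaces and smooth maps are Mathlib's `DiffeologicalSpace` and `DSmooth`. -/

section Basic

variable {X Y Z W : Type*} [DiffeologicalSpace X] [DiffeologicalSpace Y]
  [DiffeologicalSpace Z] [DiffeologicalSpace W]

/-- The sub-diffeology: a map into a subset is a plot iff it is a plot of the ambient space. -/
instance subDiffeology {p : X → Prop} : DiffeologicalSpace (Subtype p) where
  plots n := {q : EuclideanSpace ℝ (Fin n) → Subtype p |
    IsPlot (fun u => (q u : X))}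
  constant_plots _ := isPlot_const
  plot_reparam hp hf := isPlot_reparam hp hf
  locality h := DiffeologicalSpace.locality h

/-- The product diffeology: a map into a product is a plot iff both components are. -/
instance prodDiffeology : DiffeologicalSpace (X × Y) where
  plots n := {q : EuclideanSpace ℝ (Fin n) → X × Y |
    IsPlot (fun u => (q u).1) ∧ IsPlot (fun u => (q u).2)}
  constant_plots _ := ⟨isPlot_const, isPlot_const⟩
  plot_reparam hp hf := ⟨isPlot_reparam hp.1 hf, isPlot_reparam hp.2 hf⟩
  locality h := by
    refine ⟨DiffeologicalSpace.locality fun x => ?_, DiffeologicalSpace.locality fun x => ?_⟩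
    · obtain ⟨u, hu, hx, H⟩ := h x
      exact ⟨u, hu, hx, fun h1 h2 => (H h1 h2).1⟩
    · obtain ⟨u, hu, hx, H⟩ := h x
      exact ⟨u, hu, hx, fun h1 h2 => (H h1 h2).2⟩

variable (X Y) in
/-- The set `C^∞(X, Y)` of smooth maps from `X` to `Y`. -/
@[ext]
structure SmoothMap where
  toFun : X → Y
  smooth : DSmooth toFun

instance : CoeFun (SmoothMap X Y) (fun _ => X → Y) := ⟨SmoothMap.toFun⟩

/-- The functional diffeology on `C^∞(X, Y)`: a map `q : U → C^∞(X, Y)` is a plot iff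
`U × X → Y`, `(u, a) ↦ q u a` is smooth. -/
instance functionalDiffeology : DiffeologicalSpace (SmoothMap X Y) where
  plots n := {q : EuclideanSpace ℝ (Fin n) → SmoothMap X Y |
    DSmooth (fun z : EuclideanSpace ℝ (Fin n) × X => q z.1 z.2)}
  constant_plots f := fun m r hr => f.smooth m _ hr.2
  plot_reparam {n m q f} hq hf := fun k r hr =>
    hq k (fun u => (f (r u).1, (r u).2)) ⟨(hf.comp hr.1.contDiff).isPlot, hr.2⟩
  locality {n q} h := fun m r hr => by
    refine DiffeologicalSpace.locality fun w => ?_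
    obtain ⟨u, hu, hx, H⟩ := h (r w).1
    refine ⟨(fun w => (r w).1) ⁻¹' u, hu.preimage hr.1.contDiff.continuous, hx, ?_⟩
    intro k f hf hfs
    exact H (f := fun v => (r (f v)).1) hf (hr.1.contDiff.comp hfs) k
      (fun v => (v, (r (f v)).2)) ⟨isPlot_id, isPlot_reparam hr.2 hfs⟩

namespace SmoothMap

/-- The identity map. -/
protected def id : SmoothMap X X := ⟨fun x => x, dSmooth_id'⟩

/-- Composition of smooth maps. -/
def comp (g : SmoothMap Y Z) (f : SmoothMap X Y) : SmoothMap X Z :=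
  ⟨fun x => g (f x), g.smooth.comp' f.smooth⟩

/-- The constant map. -/
def const (y : Y) : SmoothMap X Y := ⟨fun _ => y, dSmooth_const⟩

end SmoothMap

/-- `x ≃ y`: there is a path, i.e. a smooth map `ℝ → X`, from `x` (at `0`) to `y` (at `1`). -/
def PathConnected (x y : X) : Prop := ∃ f : SmoothMap ℝ X, f 0 = x ∧ f 1 = y

theorem PathConnected.refl (x : X) : PathConnected x x := ⟨SmoothMap.const x, rfl, rfl⟩

theorem PathConnected.symm {x y : X} (h : PathConnected x y) : PathConnected y x := by
  obtain ⟨f, h0, h1⟩ := h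
  have hs : DSmooth (fun t : ℝ => 1 - t) :=
    ContDiff.dSmooth (contDiff_const.sub contDiff_id)
  refine ⟨f.comp ⟨_, hs⟩, ?_, ?_⟩ <;> simp [SmoothMap.comp, h0, h1]

theorem PathConnected.trans {x y z : X} (hxy : PathConnected x y) (hyz : PathConnected y z) :
    PathConnected x z := by
  obtain ⟨f, f0, f1⟩ := hxy
  obtain ⟨g, g0, g1⟩ := hyz
  have ha : DSmooth (fun t : ℝ => f (Real.smoothTransition (3 * t))) :=
    f.smooth.comp' (ContDiff.dSmooth
      (Real.smoothTransition.contDiff.comp (contDiff_const.mul contDiff_id)))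
  have hb : DSmooth (fun t : ℝ => g (Real.smoothTransition (3 * t - 2))) :=
    g.smooth.comp' (ContDiff.dSmooth
      (Real.smoothTransition.contDiff.comp ((contDiff_const.mul contDiff_id).sub contDiff_const)))
  refine ⟨⟨fun t : ℝ => if t < 1 / 2 then f (Real.smoothTransition (3 * t))
    else g (Real.smoothTransition (3 * t - 2)), ?_⟩, ?_, ?_⟩
  · intro n p hp
    refine DiffeologicalSpace.locality fun w => ?_
    by_cases hw : p w < 1 / 2
    · refine ⟨p ⁻¹' Set.Iio (2 / 3), isOpen_Iio.preimage hp.contDiff.continuous,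
        show p w < 2 / 3 by linarith, fun {m k} hk hks => ?_⟩
      have : IsPlot (fun v => f (Real.smoothTransition (3 * p (k v)))) :=
        ha m _ (isPlot_reparam hp hks)
      convert! this using 1
      funext v
      have hv : p (k v) < 2 / 3 := hk v
      simp only [Function.comp]
      split_ifs with h
      · rfl
      · rw [Real.smoothTransition.zero_of_nonpos (by linarith),
          Real.smoothTransition.one_of_one_le (by linarith), f1, g0]
    · refine ⟨p ⁻¹' Set.Ioi (1 / 3), isOpen_Ioi.preimage hp.contDiff.continuous,
        show 1 / 3 < p w by linarith, fun {m k} hk hks => ?_⟩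
      have : IsPlot (fun v => g (Real.smoothTransition (3 * p (k v) - 2))) :=
        hb m _ (isPlot_reparam hp hks)
      convert! this using 1
      funext v
      have hv : 1 / 3 < p (k v) := hk v
      simp only [Function.comp]
      split_ifs with h
      · rw [Real.smoothTransition.zero_of_nonpos (x := 3 * p (k v) - 2) (by linarith),
          Real.smoothTransition.one_of_one_le (by linarith), f1, g0]
      · rfl
  · simp [f0]
  · norm_num [g1]

variable (X) in
/-- The equivalence relation of being connected by a smooth path. -/
def pathSetoid : Setoid X :=
  ⟨PathConnected, PathConnected.refl, PathConnected.symm, PathConnected.trans⟩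

variable (X) in
/-- `π_0^D(X)`, the set of smooth path components. -/
def PiZero : Type _ := Quotient (pathSetoid X)

/-- The map induced on smooth path components by a smooth map. -/
def PiZero.map (f : SmoothMap X Y) : PiZero X → PiZero Y :=
  Quotient.map f (by
    rintro _ _ ⟨p, rfl, rfl⟩
    exact ⟨f.comp p, rfl, rfl⟩)

/-- `C^∞((X, U), (Y, V))`: smooth maps `f : X → Y` with `f(U) ⊆ V`. It carries the
sub-diffeology from `C^∞(X, Y)`. -/
abbrev PairMap (U : Set X) (V : Set Y) : Type _ :=
  {f : SmoothMap X Y // Set.MapsTo f U V}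

namespace PairMap

variable {U : Set X} {V : Set Y} {T : Set Z}

/-- The identity map of a pair. -/
protected def id (U : Set X) : PairMap U U := ⟨SmoothMap.id, fun _ h => h⟩

/-- Composition of maps of pairs. -/
def comp (g : PairMap V T) (f : PairMap U V) : PairMap U T :=
  ⟨g.1.comp f.1, fun _ h => g.2 (f.2 h)⟩

variable (U) in
/-- Composition with a map of pairs `(Y, V) → (Z, T)`, as a smooth map
`C^∞((X, U), (Y, V)) → C^∞((X, U), (Z, T))`. -/
def postcomp (g : PairMap V T) : SmoothMap (PairMap U V) (PairMap U T) where
  toFun f := g.comp f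
  smooth _ _ hq := fun k r hr => g.1.smooth k _ (hq k r hr)

end PairMap

/-- Smoothly homotopic maps of pairs: they lie in the same smooth path component of
`C^∞((X, U), (Y, V))`. -/
def SmoothlyHomotopic {U : Set X} {V : Set Y} (f g : PairMap U V) : Prop := PathConnected f g

end Basic

/-- A pair of diffeological spaces: a space together with a subset (carrying the
sub-diffeology). -/
structure Pair where
  carrier : Type
  [diffeology : DiffeologicalSpace carrier]
  sub : Set carrier

attribute [instance] Pair.diffeology

/-- Smooth homotopy equivalence of pairs. -/
def Pair.SmoothlyHomotopyEquivalent (P Q : Pair) : Prop :=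
  ∃ (f : PairMap P.sub Q.sub) (g : PairMap Q.sub P.sub),
    SmoothlyHomotopic (f.comp g) (PairMap.id Q.sub) ∧
    SmoothlyHomotopic (g.comp f) (PairMap.id P.sub)

/-- A pointed diffeological space `(X, x)`. -/
structure Pointed where
  carrier : Type u
  [diffeology : DiffeologicalSpace carrier]
  pt : carrier

attribute [instance] Pointed.diffeology

namespace Pointed

/-- Pointed smooth maps `(X, x) → (Y, y)`. -/
abbrev Hom (X Y : Pointed.{u}) : Type u :=
  PairMap ({X.pt} : Set X.carrier) ({Y.pt} : Set Y.carrier)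

/-- The loop space `Ω(X, x) = C^∞((ℝ, {0, 1}), (X, x))`, based at the constant loop. -/
def loop (X : Pointed.{u}) : Pointed.{u} where
  carrier := PairMap ({0, 1} : Set ℝ) ({X.pt} : Set X.carrier)
  pt := ⟨SmoothMap.const X.pt, fun _ _ => rfl⟩

/-- The map induced by a pointed smooth map on loop spaces. -/
def loopMap {X Y : Pointed.{u}} (f : X.Hom Y) : X.loop.Hom Y.loop :=
  ⟨PairMap.postcomp ({0, 1} : Set ℝ) f, by
    rintro _ rfl
    exact Subtype.ext (SmoothMap.ext (funext fun _ => f.2 rfl))⟩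

/-- The iterated loop space `Ω^n(X, x)`. -/
def iterLoop : ℕ → Pointed.{u} → Pointed.{u}
  | 0, X => X
  | n + 1, X => (iterLoop n X).loop

/-- The map induced by a pointed smooth map on iterated loop spaces. -/
def iterLoopMap {X Y : Pointed.{u}} (f : X.Hom Y) :
    (n : ℕ) → (iterLoop n X).Hom (iterLoop n Y)
  | 0 => f
  | n + 1 => loopMap (iterLoopMap f n)

/-- The smooth homotopy set `π_n^D(X, x) = π_0^D(Ω^n(X, x))`. -/
def HomotopySet (n : ℕ) (X : Pointed.{u}) : Type u := PiZero (iterLoop n X).carrier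

/-- The map induced by a pointed smooth map on `π_n^D`. -/
def homotopySetMap (n : ℕ) {X Y : Pointed.{u}} (f : X.Hom Y) :
    HomotopySet n X → HomotopySet n Y :=
  PiZero.map (iterLoopMap f n).1

end Pointed

namespace Pair

/-- `[(A, B), (X, x)] = π_0^D(C^∞((A, B), (X, x)))`. -/
def Classes (P : Pair) (X : Pointed.{u}) : Type u :=
  PiZero (PairMap P.sub ({X.pt} : Set X.carrier))

/-- The map `[(A, B), (X, x)] → [(A, B), (Y, y)]` induced by a pointed smooth map. -/
def classesMap (P : Pair) {X Y : Pointed.{u}} (f : X.Hom Y) : P.Classes X → P.Classes Y :=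
  PiZero.map (PairMap.postcomp P.sub f)

/-- There are bijections `[(A, B), (X, x)] ≃ π_n^D(X, x)`, one for each pointed diffeological
space `(X, x)`, that are natural in `(X, x)`. -/
def NaturallyBijects (P : Pair) (n : ℕ) : Prop :=
  ∃ e : ∀ X : Pointed.{u}, P.Classes X ≃ X.HomotopySet n,
    ∀ (X Y : Pointed.{u}) (f : X.Hom Y) (c : P.Classes X),
      e Y (P.classesMap f c) = Pointed.homotopySetMap n f (e X c)

/-- `(ℝ^n, ∂ℝ^n)`. -/
def euclidean (n : ℕ) : Pair where
  carrier := EuclideanSpace ℝ (Fin n)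
  sub := {x | ∃ i, x i = 0 ∨ x i = 1}

/-- `(ℝ^n, ∂_ε ℝ^n)`. -/
def euclideanThick (n : ℕ) (ε : ℝ) : Pair where
  carrier := EuclideanSpace ℝ (Fin n)
  sub := {x | ∃ i, x i ≤ ε ∨ 1 - ε ≤ x i}

/-- The unit cube `I^n`. -/
abbrev Cube (n : ℕ) : Type := {x : EuclideanSpace ℝ (Fin n) // ∀ i, 0 ≤ x i ∧ x i ≤ 1}

/-- `(I^n, ∂I^n)`. -/
def cube (n : ℕ) : Pair where
  carrier := Cube n
  sub := {x | ∃ i, x.1 i = 0 ∨ x.1 i = 1}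

/-- `(I^n, ∂_ε I^n)`. -/
def cubeThick (n : ℕ) (ε : ℝ) : Pair where
  carrier := Cube n
  sub := {x | ∃ i, x.1 i ≤ ε ∨ 1 - ε ≤ x.1 i}

/-- The noncompact simplex `𝔸^n`. -/
abbrev Simplex (n : ℕ) : Type := {x : EuclideanSpace ℝ (Fin (n + 1)) // ∑ i, x i = 1}

/-- `(𝔸^n, ∂𝔸^n)`. -/
def simplex (n : ℕ) : Pair where
  carrier := Simplex n
  sub := {x | ∃ i, x.1 i = 0}

/-- `(𝔸^n, ∂_ε 𝔸^n)`. -/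
def simplexThick (n : ℕ) (ε : ℝ) : Pair where
  carrier := Simplex n
  sub := {x | ∃ i, x.1 i ≤ ε}

/-- The closed unit ball `D^n`. -/
abbrev Disk (n : ℕ) : Type := {x : EuclideanSpace ℝ (Fin n) // ‖x‖ ≤ 1}

/-- `(D^n, ∂D^n)`. -/
def disk (n : ℕ) : Pair where
  carrier := Disk n
  sub := {x | ‖x.1‖ = 1}

/-- `(D^n, ∂_ε D^n)`. -/
def diskThick (n : ℕ) (ε : ℝ) : Pair where
  carrier := Disk n
  sub := {x | 1 - ε < ‖x.1‖}

/-- `(S^n, N)`, where `S^n` is the unit sphere in `ℝ^(n+1)` and `N = (0, …, 0, 1)`. -/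
def sphere (n : ℕ) : Pair where
  carrier := {x : EuclideanSpace ℝ (Fin (n + 1)) // ‖x‖ = 1}
  sub := {x | x.1 = EuclideanSpace.single (Fin.last n) 1}

end Pair

end SmoothHomotopy

end

open SmoothHomotopy

/-! The pair `(ℝ^n, ∂ℝ^n)` is the reference model. By the exponential law, a smooth map on `ℝ^(n+1)`
is a smooth path of maps on `ℝ^n`. A point of `ℝ^(n+1)` lies on the boundary exactly when its first
coordinate is `0` or `1` or the remaining ones lie on `∂ℝ^n`. By induction, maps `(ℝ^n, ∂ℝ^n) → (X,
x)` form a space isomorphic to `Ω^n(X, x)`, naturally in `(X, x)` (`naturallyBijects_euclidean`). A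
smooth homotopy equivalence of pairs induces natural bijections on classes, so the other pairs only
have to be compared with this one.

For pairs 1 to 8 the homotopies are straight segments. A smooth map that flattens a neighbourhood of
the boundary onto the boundary relates thin and thick boundaries
(`IsCubical.smoothlyHomotopyEquivalent`, `diskPair_equivalent_outside`,
`simplex_equivalent_simplexThick`). After translating the centre to the origin, thick boundaries
become complements of bounded star-shaped neighbourhoods of the origin, which are all equivalent by
dilation (`IsStarBody.smoothlyHomotopyEquivalent`).

The sphere is compared through mapping spaces instead. Its pole can be thickened to an open polar
cap (`sphereThick_equivalent_sphere`). A map constant on the cap corresponds under stereographic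
projection to a map on `ℝ^n` constant outside a disk; conversely such a map extends smoothly over
the pole because it is constant nearby (`dSmooth_sphereExtend`). -/

noncomputable section

namespace SmoothHomotopy

/-! ### Smoothness calculus for subspaces, products and coordinates. -/

section Smoothness

variable {X Y Z : Type*} [DiffeologicalSpace X] [DiffeologicalSpace Y] [DiffeologicalSpace Z]

theorem dSmooth_fst : DSmooth (Prod.fst : X × Y → X) := fun _ _ h => h.1

theorem dSmooth_snd : DSmooth (Prod.snd : X × Y → Y) := fun _ _ h => h.2

theorem dSmooth_prodMk {f : X → Y} {g : X → Z} (hf : DSmooth f) (hg : DSmooth g) :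
    DSmooth (fun x => (f x, g x)) := fun n p hp => ⟨hf n p hp, hg n p hp⟩

theorem dSmooth_subtypeVal {p : X → Prop} : DSmooth (Subtype.val : Subtype p → X) :=
  fun _ _ h => h

theorem dSmooth_subtypeMk {p : Y → Prop} {f : X → Y} (hf : DSmooth f) (h : ∀ x, p (f x)) :
    DSmooth (fun x => (⟨f x, h x⟩ : Subtype p)) := hf

/-- Smoothness of maps is local for covers whose preimages under plots are open. -/
theorem dSmooth_of_locally {f : X → Y}
    (h : ∀ x, ∃ (s : Set X) (g : X → Y), x ∈ s ∧ (∀ (n : ℕ) (p : EuclideanSpace ℝ (Fin n) → X),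
      IsPlot p → IsOpen (p ⁻¹' s)) ∧ Set.EqOn f g s ∧ ∀ (n : ℕ)
      (p : EuclideanSpace ℝ (Fin n) → X), IsPlot p → (∀ u, p u ∈ s) → IsPlot (g ∘ p)) :
    DSmooth f := by
  intro n p hp
  refine DiffeologicalSpace.locality fun w => ?_
  obtain ⟨s, g, hxs, hs, hfg, hg⟩ := h (p w)
  refine ⟨p ⁻¹' s, hs n p hp, hxs, fun {m k} hk hks => ?_⟩
  have h1 := hg m (p ∘ k) (isPlot_reparam hp hks) hk
  have : (f ∘ p) ∘ k = g ∘ p ∘ k := funext fun v => hfg (hk v)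
  rw [this]
  exact h1

/-- An induction: an injective map such that the source carries the pulled back diffeology. -/
structure IsInduction (j : X → Y) : Prop where
  injective : Function.Injective j
  isPlot_iff : ∀ {n : ℕ} {q : EuclideanSpace ℝ (Fin n) → X}, IsPlot q ↔ IsPlot (fun u => j (q u))

theorem isInduction_id : IsInduction (id : X → X) := ⟨Function.injective_id, Iff.rfl⟩

theorem isInduction_subtypeVal {p : X → Prop} : IsInduction (Subtype.val : Subtype p → X) :=
  ⟨Subtype.val_injective, Iff.rfl⟩

theorem IsInduction.dSmooth {j : X → Y} (hj : IsInduction j) : DSmooth j :=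
  fun _ _ h => hj.isPlot_iff.1 h

theorem IsInduction.dSmooth_of_comp {j : Y → Z} (hj : IsInduction j) {f : X → Y}
    (hf : DSmooth (fun x => j (f x))) : DSmooth f :=
  fun n p hp => hj.isPlot_iff.2 (hf n p hp)

variable {ι : Type*} [Fintype ι]

/-- A map into Euclidean space is smooth if its coordinates are. -/
theorem dSmooth_euclidean {f : X → EuclideanSpace ℝ ι} :
    DSmooth f ↔ ∀ i, DSmooth (fun x => f x i) := by
  refine ⟨fun h i n p hp => ?_, fun h n p hp => ?_⟩
  · exact (contDiff_euclidean.1 (h n p hp).contDiff i).isPlot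
  · exact (contDiff_euclidean.2 fun i => (h i n p hp).contDiff).isPlot

theorem dSmooth_apply (i : ι) : DSmooth (fun x : EuclideanSpace ℝ ι => x i) :=
  dSmooth_euclidean.1 dSmooth_id' i

section Arithmetic

variable {f g : X → ℝ} {v w : X → EuclideanSpace ℝ ι}

theorem dSmooth_real_add (hf : DSmooth f) (hg : DSmooth g) : DSmooth (fun x => f x + g x) :=
  fun n p hp => ((hf n p hp).contDiff.add (hg n p hp).contDiff).isPlot

theorem dSmooth_real_sub (hf : DSmooth f) (hg : DSmooth g) : DSmooth (fun x => f x - g x) :=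
  fun n p hp => ((hf n p hp).contDiff.sub (hg n p hp).contDiff).isPlot

theorem dSmooth_real_mul (hf : DSmooth f) (hg : DSmooth g) : DSmooth (fun x => f x * g x) :=
  fun n p hp => ((hf n p hp).contDiff.mul (hg n p hp).contDiff).isPlot

theorem dSmooth_real_div (hf : DSmooth f) (hg : DSmooth g) (h : ∀ x, g x ≠ 0) :
    DSmooth (fun x => f x / g x) :=
  fun n p hp => ((hf n p hp).contDiff.div (hg n p hp).contDiff fun u => h (p u)).isPlot

theorem dSmooth_real_inv (hf : DSmooth f) (h : ∀ x, f x ≠ 0) : DSmooth (fun x => (f x)⁻¹) :=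
  fun n p hp => ((hf n p hp).contDiff.inv fun u => h (p u)).isPlot

theorem dSmooth_real_sqrt (hf : DSmooth f) (h : ∀ x, f x ≠ 0) : DSmooth (fun x => √(f x)) :=
  fun n p hp => ((hf n p hp).contDiff.sqrt fun u => h (p u)).isPlot

theorem dSmooth_real_sum {κ : Type*} {s : Finset κ} {F : κ → X → ℝ} (h : ∀ i, DSmooth (F i)) :
    DSmooth (fun x => ∑ i ∈ s, F i x) :=
  fun n p hp => (ContDiff.sum fun i _ => (h i n p hp).contDiff).isPlot

theorem dSmooth_smoothTransition (hf : DSmooth f) :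
    DSmooth (fun x => Real.smoothTransition (f x)) :=
  fun n p hp => (Real.smoothTransition.contDiff.comp (hf n p hp).contDiff).isPlot

theorem dSmooth_add (hv : DSmooth v) (hw : DSmooth w) : DSmooth (fun x => v x + w x) :=
  fun n p hp => ((hv n p hp).contDiff.add (hw n p hp).contDiff).isPlot

theorem dSmooth_sub (hv : DSmooth v) (hw : DSmooth w) : DSmooth (fun x => v x - w x) :=
  fun n p hp => ((hv n p hp).contDiff.sub (hw n p hp).contDiff).isPlot

theorem dSmooth_smul (hf : DSmooth f) (hv : DSmooth v) : DSmooth (fun x => f x • v x) :=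
  fun n p hp => ((hf n p hp).contDiff.smul (hv n p hp).contDiff).isPlot

theorem dSmooth_norm_sq (hv : DSmooth v) : DSmooth (fun x => ‖v x‖ ^ 2) :=
  fun n p hp => ((hv n p hp).contDiff.norm_sq ℝ).isPlot

end Arithmetic

end Smoothness

/-! ### Function spaces and homotopies of maps of pairs. -/

section Homotopy

variable {X Y Z : Type*} [DiffeologicalSpace X] [DiffeologicalSpace Y] [DiffeologicalSpace Z]
  {U : Set X} {V : Set Y} {T : Set Z}

theorem SmoothMap.dSmooth_apply_left (x : X) : DSmooth (fun f : SmoothMap X Y => f x) :=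
  fun n _ hp => hp n (fun u => (u, x)) ⟨isPlot_id, isPlot_const⟩

theorem SmoothMap.dSmooth_curry {F : X → SmoothMap Y Z}
    (hF : DSmooth (fun z : X × Y => F z.1 z.2)) : DSmooth F :=
  fun _ _ hp => fun m r hr => hF m (fun u => ((_, (r u).2) : X × Y)) ⟨hp.dSmooth m _ hr.1, hr.2⟩

theorem SmoothMap.dSmooth_uncurry {F : X → SmoothMap Y Z} (hF : DSmooth F) :
    DSmooth (fun z : X × Y => F z.1 z.2) :=
  fun n p hp => hF n _ hp.1 n (fun u => (u, (p u).2)) ⟨isPlot_id, hp.2⟩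

/-- Composition with a map of pairs `(X, U) → (Y, V)`, as a smooth map
`C^∞((Y, V), (Z, T)) → C^∞((X, U), (Z, T))`. -/
def PairMap.precomp (T : Set Z) (f : PairMap U V) : SmoothMap (PairMap V T) (PairMap U T) where
  toFun g := g.comp f
  smooth _ _ hq := fun k r hr => hq k (fun u => ((r u).1, f.1 (r u).2)) ⟨hr.1, f.1.smooth k _ hr.2⟩

theorem SmoothlyHomotopic.comp_left {f g : PairMap U V} (h : SmoothlyHomotopic f g)
    (k : PairMap V T) : SmoothlyHomotopic (k.comp f) (k.comp g) := by
  obtain ⟨p, rfl, rfl⟩ := h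
  exact ⟨(PairMap.postcomp U k).comp p, rfl, rfl⟩

theorem SmoothlyHomotopic.comp_right {f g : PairMap V T} (h : SmoothlyHomotopic f g)
    (k : PairMap U V) : SmoothlyHomotopic (f.comp k) (g.comp k) := by
  obtain ⟨p, rfl, rfl⟩ := h
  exact ⟨(PairMap.precomp T k).comp p, rfl, rfl⟩

theorem smoothlyHomotopic_of_dSmooth {f g : PairMap U V} (H : ℝ → X → Y)
    (hH : DSmooth (fun z : ℝ × X => H z.1 z.2)) (hm : ∀ t, Set.MapsTo (H t) U V)
    (h0 : ∀ x, H 0 x = f.1 x) (h1 : ∀ x, H 1 x = g.1 x) : SmoothlyHomotopic f g := by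
  let F : ℝ → SmoothMap X Y := fun t =>
    ⟨H t, hH.comp' (dSmooth_prodMk dSmooth_const dSmooth_id')⟩
  have hF : DSmooth F := SmoothMap.dSmooth_curry hH
  exact ⟨⟨fun t => ⟨F t, hm t⟩, hF⟩, Subtype.ext (SmoothMap.ext (funext h0)),
    Subtype.ext (SmoothMap.ext (funext h1))⟩

/-- Maps of pairs into a subspace of Euclidean space are homotopic if the segments joining their
values stay in the pair. -/
theorem smoothlyHomotopic_of_segment {ι : Type*} [Fintype ι] {j : Y → EuclideanSpace ℝ ι}
    (hj : IsInduction j) {f g : PairMap U V}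
    (h : ∀ x, ∀ s ∈ Set.Icc (0 : ℝ) 1, ∃ y, j y = (1 - s) • j (f.1 x) + s • j (g.1 x) ∧
      (x ∈ U → y ∈ V)) : SmoothlyHomotopic f g := by
  -- Homotopies are parametrised by all of `ℝ`, so the segment parameter is cut off smoothly to stay
  -- in `[0, 1]`. The points `H t x` chosen below need no separate smoothness argument: `j` is an
  -- induction, and `j (H t x)` is an explicit formula.
  have hs : ∀ t, Real.smoothTransition t ∈ Set.Icc (0 : ℝ) 1 := fun t =>
    ⟨Real.smoothTransition.nonneg t, Real.smoothTransition.le_one t⟩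
  choose H hH hHV using fun (t : ℝ) (x : X) => h x (Real.smoothTransition t) (hs t)
  refine smoothlyHomotopic_of_dSmooth H (hj.dSmooth_of_comp ?_) (fun t x hx => hHV t x hx)
    (fun x => hj.injective ?_) (fun x => hj.injective ?_)
  · simp only [hH]
    have h1 := dSmooth_smoothTransition (dSmooth_fst (X := ℝ) (Y := X))
    exact dSmooth_add
      (dSmooth_smul (dSmooth_real_sub dSmooth_const h1)
        (hj.dSmooth.comp' (f.1.smooth.comp' dSmooth_snd)))
      (dSmooth_smul h1 (hj.dSmooth.comp' (g.1.smooth.comp' dSmooth_snd)))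
  · simp [hH]
  · simp [hH]

end Homotopy

/-! ### Homotopy equivalence of pairs and invariance of homotopy classes. -/

namespace Pair

theorem SmoothlyHomotopyEquivalent.refl (P : Pair) : P.SmoothlyHomotopyEquivalent P :=
  ⟨PairMap.id _, PairMap.id _, PathConnected.refl _, PathConnected.refl _⟩

theorem SmoothlyHomotopyEquivalent.symm {P Q : Pair} (h : P.SmoothlyHomotopyEquivalent Q) :
    Q.SmoothlyHomotopyEquivalent P := by
  obtain ⟨f, g, h1, h2⟩ := h
  exact ⟨g, f, h2, h1⟩

theorem SmoothlyHomotopyEquivalent.trans {P Q R : Pair} (h : P.SmoothlyHomotopyEquivalent Q)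
    (h' : Q.SmoothlyHomotopyEquivalent R) : P.SmoothlyHomotopyEquivalent R := by
  obtain ⟨f, g, h1, h2⟩ := h
  obtain ⟨f', g', h1', h2'⟩ := h'
  exact ⟨f'.comp f, g.comp g',
    PathConnected.trans (SmoothlyHomotopic.comp_left (SmoothlyHomotopic.comp_right h1 g') f') h1',
    PathConnected.trans (SmoothlyHomotopic.comp_left (SmoothlyHomotopic.comp_right h2' f) g) h2⟩

/-- Natural bijections `[(A, B), (X, x)] ≃ π_n^D(X, x)` transport along natural bijections of the
sets of classes. -/
theorem NaturallyBijects.of_equiv {P Q : Pair} {n : ℕ} (hP : NaturallyBijects.{u} P n)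
    (e : ∀ X : Pointed.{u}, Q.Classes X ≃ P.Classes X)
    (he : ∀ (X Y : Pointed.{u}) (f : X.Hom Y) (c : Q.Classes X),
      e Y (Q.classesMap f c) = P.classesMap f (e X c)) : NaturallyBijects.{u} Q n := by
  obtain ⟨e', he'⟩ := hP
  refine ⟨fun X => (e X).trans (e' X), fun X Y f c => ?_⟩
  simp only [Equiv.trans_apply, he, he']

/-- The map `[Q, (X, x)] → [P, (X, x)]` induced by a map of pairs `P → Q`. -/
def classesPrecomp {P Q : Pair} (f : PairMap P.sub Q.sub) (X : Pointed.{u}) :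
    Q.Classes X → P.Classes X :=
  PiZero.map (PairMap.precomp ({X.pt} : Set X.carrier) f)

theorem classesPrecomp_leftInverse {P Q : Pair} {f : PairMap P.sub Q.sub}
    {g : PairMap Q.sub P.sub} (h : SmoothlyHomotopic (f.comp g) (PairMap.id Q.sub))
    (X : Pointed.{u}) :
    Function.LeftInverse (classesPrecomp g X) (classesPrecomp f X) := by
  rintro ⟨k⟩
  exact Quotient.sound (SmoothlyHomotopic.comp_left h k)

theorem NaturallyBijects.of_smoothlyHomotopyEquivalent {P Q : Pair} {n : ℕ}
    (hP : NaturallyBijects.{u} P n) (h : P.SmoothlyHomotopyEquivalent Q) :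
    NaturallyBijects.{u} Q n := by
  obtain ⟨f, g, h1, h2⟩ := h
  refine hP.of_equiv (fun X => ⟨classesPrecomp f X, classesPrecomp g X,
    classesPrecomp_leftInverse h1 X, classesPrecomp_leftInverse h2 X⟩) ?_
  rintro X Y k ⟨c⟩
  -- Naturality is definitional: precomposition with `f` and postcomposition with `k` commute.
  rfl

end Pair

/-! ### The exponential law: maps of cubes and iterated loops. -/

namespace Pointed

variable {X Y : Pointed.{u}}

/-- The space of maps `(ℝ^n, ∂ℝ^n) → (X, x)`, based at the constant map. -/
def cubeMaps (n : ℕ) (X : Pointed.{u}) : Pointed.{u} where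
  carrier := PairMap (Pair.euclidean n).sub ({X.pt} : Set X.carrier)
  pt := ⟨SmoothMap.const X.pt, fun _ _ => rfl⟩

/-- The map induced by a pointed smooth map on spaces of maps `(ℝ^n, ∂ℝ^n) → (X, x)`. -/
def cubeMapsMap (n : ℕ) (f : X.Hom Y) : (cubeMaps n X).Hom (cubeMaps n Y) :=
  ⟨PairMap.postcomp (Pair.euclidean n).sub f, by
    rintro _ rfl
    exact Subtype.ext (SmoothMap.ext (funext fun _ => f.2 rfl))⟩

end Pointed

/-- The point of `ℝ^(n+1)` with first coordinate `t` and remaining coordinates `y`. -/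
def euclideanCons {n : ℕ} (t : ℝ) (y : EuclideanSpace ℝ (Fin n)) : EuclideanSpace ℝ (Fin (n + 1)) :=
  WithLp.toLp 2 (Fin.cons (α := fun _ => ℝ) t y.ofLp)

/-- The last `n` coordinates of a point of `ℝ^(n+1)`. -/
def euclideanTail {n : ℕ} (x : EuclideanSpace ℝ (Fin (n + 1))) : EuclideanSpace ℝ (Fin n) :=
  WithLp.toLp 2 fun i => x i.succ

section Cons

variable {n : ℕ}

@[simp]
theorem euclideanCons_zero (t : ℝ) (y : EuclideanSpace ℝ (Fin n)) : euclideanCons t y 0 = t := rfl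

@[simp]
theorem euclideanCons_succ (t : ℝ) (y : EuclideanSpace ℝ (Fin n)) (i : Fin n) :
    euclideanCons t y i.succ = y i := rfl

@[simp]
theorem euclideanCons_tail (x : EuclideanSpace ℝ (Fin (n + 1))) :
    euclideanCons (x 0) (euclideanTail x) = x := by
  ext i
  refine Fin.cases rfl (fun _ => rfl) i

theorem dSmooth_euclideanCons :
    DSmooth (fun z : ℝ × EuclideanSpace ℝ (Fin n) => euclideanCons z.1 z.2) := by
  refine dSmooth_euclidean.2 fun i => ?_
  induction i using Fin.cases with
  | zero => exact dSmooth_fst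
  | succ i => exact (dSmooth_apply i).comp' dSmooth_snd

theorem dSmooth_euclideanTail :
    DSmooth (euclideanTail : EuclideanSpace ℝ (Fin (n + 1)) → EuclideanSpace ℝ (Fin n)) :=
  dSmooth_euclidean.2 fun i => dSmooth_apply i.succ

/-- The two alternatives are the two conditions on a curried map: the faces of the first coordinate
say that the path is a loop at the constant map, the other faces say that each of its values is a
map of pairs. -/
theorem euclideanCons_mem_euclidean_sub {t : ℝ} {y : EuclideanSpace ℝ (Fin n)} :
    (euclideanCons t y : EuclideanSpace ℝ (Fin (n + 1))) ∈ (Pair.euclidean (n + 1)).sub ↔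
      t ∈ ({0, 1} : Set ℝ) ∨ y ∈ (Pair.euclidean n).sub :=
  Fin.exists_fin_succ

end Cons

namespace Pointed

variable {X Y : Pointed.{u}}

/-- Currying the first coordinate of maps `(ℝ^(n+1), ∂ℝ^(n+1)) → (X, x)`. -/
def curryCube (n : ℕ) (X : Pointed.{u}) : (cubeMaps (n + 1) X).Hom (cubeMaps n X).loop where
  val :=
    { toFun f :=
        have hf : DSmooth (fun z : ℝ × EuclideanSpace ℝ (Fin n) => f.1 (euclideanCons z.1 z.2)) :=
          f.1.smooth.comp' dSmooth_euclideanCons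
        ⟨⟨fun t => ⟨⟨fun y => f.1 (euclideanCons t y),
            hf.comp' (dSmooth_prodMk dSmooth_const dSmooth_id')⟩,
            fun _ hy => f.2 (euclideanCons_mem_euclidean_sub.2 (Or.inr hy))⟩,
          SmoothMap.dSmooth_curry (F := fun t => (⟨fun y => f.1 (euclideanCons t y),
            hf.comp' (dSmooth_prodMk dSmooth_const dSmooth_id')⟩ :
              SmoothMap (EuclideanSpace ℝ (Fin n)) X.carrier)) hf⟩,
          fun _ ht => Subtype.ext (SmoothMap.ext (funext fun _ =>
            f.2 (euclideanCons_mem_euclidean_sub.2 (Or.inl ht))))⟩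
      smooth _ _ hq := fun _ r hr => fun k s hs =>
        hq k (fun u => ((r (s u).1).1, euclideanCons (r (s u).1).2 (s u).2))
          ⟨hr.1.dSmooth k _ hs.1, dSmooth_euclideanCons k
            (fun u => ((r (s u).1).2, (s u).2)) ⟨hr.2.dSmooth k _ hs.1, hs.2⟩⟩ }
  property := by rintro _ rfl; rfl

/-- Uncurrying loops in the space of maps `(ℝ^n, ∂ℝ^n) → (X, x)`. -/
def uncurryCube (n : ℕ) (X : Pointed.{u}) : (cubeMaps n X).loop.Hom (cubeMaps (n + 1) X) where
  val :=
    { toFun f :=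
        ⟨⟨fun x : EuclideanSpace ℝ (Fin (n + 1)) => (f.1 (x 0)).1 (euclideanTail x),
          (SmoothMap.dSmooth_uncurry (F := fun t => (f.1 t).1)
            (dSmooth_subtypeVal.comp' f.1.smooth)).comp'
              (dSmooth_prodMk (dSmooth_apply 0) dSmooth_euclideanTail)⟩, by
          intro (x : EuclideanSpace ℝ (Fin (n + 1))) hx
          rw [← euclideanCons_tail x] at hx
          rcases euclideanCons_mem_euclidean_sub.1 hx with h | h
          · have := f.2 h
            exact congrArg (fun k => k.1 (euclideanTail x)) this
          · exact (f.1 (x 0)).2 h⟩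
      smooth _ _ hq := fun k r hr =>
        hq k (fun u => ((r u).1, (show EuclideanSpace ℝ (Fin (n + 1)) from (r u).2) 0))
          ⟨hr.1, dSmooth_apply (0 : Fin (n + 1)) k _ hr.2⟩ k
          (fun u => (u, euclideanTail (r u).2)) ⟨isPlot_id, dSmooth_euclideanTail k _ hr.2⟩ }
  property := by rintro _ rfl; rfl

theorem uncurryCube_comp_curryCube (n : ℕ) (X : Pointed.{u}) :
    (uncurryCube n X).comp (curryCube n X) = PairMap.id _ :=
  Subtype.ext (SmoothMap.ext (funext fun f => Subtype.ext (SmoothMap.ext (funext fun x =>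
    congrArg f.1.toFun (euclideanCons_tail x)))))

/-- The comparison of maps `(ℝ^n, ∂ℝ^n) → (X, x)` with the iterated loop space. -/
def cubeMapsToIterLoop (X : Pointed.{u}) : (n : ℕ) → (cubeMaps n X).Hom (iterLoop n X)
  | 0 => ⟨⟨fun f => f.1 (0 : EuclideanSpace ℝ (Fin 0)),
      (SmoothMap.dSmooth_apply_left (X := EuclideanSpace ℝ (Fin 0)) 0).comp' dSmooth_subtypeVal⟩,
      by rintro _ rfl; rfl⟩
  | n + 1 => (loopMap (cubeMapsToIterLoop X n)).comp (curryCube n X)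

/-- The inverse of `cubeMapsToIterLoop`. -/
def iterLoopToCubeMaps (X : Pointed.{u}) : (n : ℕ) → (iterLoop n X).Hom (cubeMaps n X)
  | 0 => ⟨⟨fun x => ⟨SmoothMap.const x, fun _ h => h.elim fun i _ => i.elim0⟩,
      fun _ _ hp => fun _ _ hr => hp.dSmooth _ _ hr.1⟩, by rintro _ rfl; rfl⟩
  | n + 1 => (uncurryCube n X).comp (loopMap (iterLoopToCubeMaps X n))

theorem iterLoopToCubeMaps_comp (X : Pointed.{u}) (n : ℕ) :
    (iterLoopToCubeMaps X n).comp (cubeMapsToIterLoop X n) = PairMap.id _ := by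
  induction n with
  | zero =>
    refine Subtype.ext (SmoothMap.ext (funext fun f => Subtype.ext (SmoothMap.ext (funext fun x =>
      congrArg f.1.toFun ?_))))
    exact Subsingleton.elim (α := EuclideanSpace ℝ (Fin 0)) _ _
  | succ n ih =>
    -- Composition is associative and `loopMap` respects it, both definitionally, so the two
    -- comparison maps of level `n` can be brought together inside a single `loopMap`.
    change (uncurryCube n X).comp ((loopMap ((iterLoopToCubeMaps X n).comp
      (cubeMapsToIterLoop X n))).comp (curryCube n X)) = _
    rw [ih]
    exact uncurryCube_comp_curryCube n X

theorem cubeMapsToIterLoop_comp (X : Pointed.{u}) (n : ℕ) :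
    (cubeMapsToIterLoop X n).comp (iterLoopToCubeMaps X n) = PairMap.id _ := by
  induction n with
  | zero => rfl
  | succ n ih =>
    -- In this order currying after uncurrying cancels definitionally, since the head and tail of
    -- `euclideanCons t y` reduce to `t` and `y`.
    change loopMap ((cubeMapsToIterLoop X n).comp (iterLoopToCubeMaps X n)) = _
    rw [ih]
    rfl

theorem cubeMapsToIterLoop_natural (n : ℕ) (f : X.Hom Y) :
    (cubeMapsToIterLoop Y n).comp (cubeMapsMap n f) =
      (iterLoopMap f n).comp (cubeMapsToIterLoop X n) := by
  induction n with
  | zero => rfl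
  | succ n ih =>
    change (loopMap ((cubeMapsToIterLoop Y n).comp (cubeMapsMap n f))).comp (curryCube n X) = _
    rw [ih]
    rfl

end Pointed

theorem PiZero.map_leftInverse {X Y : Type*} [DiffeologicalSpace X] [DiffeologicalSpace Y]
    {f : SmoothMap X Y} {g : SmoothMap Y X} (h : ∀ x, g (f x) = x) :
    Function.LeftInverse (PiZero.map g) (PiZero.map f) := by
  rintro ⟨x⟩
  exact congrArg _ (h x)

namespace Pair

theorem naturallyBijects_euclidean (n : ℕ) : NaturallyBijects.{u} (euclidean n) n := by
  refine ⟨fun X => ⟨PiZero.map (Pointed.cubeMapsToIterLoop X n).1,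
    PiZero.map (Pointed.iterLoopToCubeMaps X n).1, PiZero.map_leftInverse fun x => ?_,
    PiZero.map_leftInverse fun x => ?_⟩, ?_⟩
  · exact congrArg (fun k => k.1 x) (Pointed.iterLoopToCubeMaps_comp X n)
  · exact congrArg (fun k => k.1 x) (Pointed.cubeMapsToIterLoop_comp X n)
  · rintro X Y f ⟨c⟩
    exact congrArg (fun k => Quotient.mk _ (k.1 c)) (Pointed.cubeMapsToIterLoop_natural n f)

end Pair

namespace Pair

theorem smoothlyHomotopyEquivalent_of_inverse {P Q : Pair} (f : PairMap P.sub Q.sub)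
    (g : PairMap Q.sub P.sub) (hfg : ∀ x, f.1 (g.1 x) = x) (hgf : ∀ x, g.1 (f.1 x) = x) :
    P.SmoothlyHomotopyEquivalent Q := by
  have h1 : f.comp g = PairMap.id Q.sub := Subtype.ext (SmoothMap.ext (funext hfg))
  have h2 : g.comp f = PairMap.id P.sub := Subtype.ext (SmoothMap.ext (funext hgf))
  exact ⟨f, g, h1 ▸ PathConnected.refl _, h2 ▸ PathConnected.refl _⟩

/-! ### Cubes -/

/-- The map `ℝ → [0, 1]` which is `0` on `(-∞, ε]` and `1` on `[1 - ε, ∞)`. -/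
def collapse (ε t : ℝ) : ℝ := Real.smoothTransition ((t - ε) * (1 - 2 * ε)⁻¹)

theorem collapse_mem (ε t : ℝ) : 0 ≤ collapse ε t ∧ collapse ε t ≤ 1 :=
  ⟨Real.smoothTransition.nonneg _, Real.smoothTransition.le_one _⟩

theorem collapse_eq_zero {ε t : ℝ} (hε : ε < 1 / 2) (h : t ≤ ε) : collapse ε t = 0 :=
  Real.smoothTransition.zero_of_nonpos (mul_nonpos_of_nonpos_of_nonneg (by linarith)
    (inv_nonneg.2 (by linarith)))

theorem collapse_eq_one {ε t : ℝ} (hε : ε < 1 / 2) (h : 1 - ε ≤ t) : collapse ε t = 1 :=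
  Real.smoothTransition.one_of_one_le (by
    rw [← div_eq_mul_inv, one_le_div (by linarith)]
    linarith)

theorem dSmooth_collapse (ε : ℝ) : DSmooth (collapse ε) :=
  dSmooth_smoothTransition (dSmooth_real_mul (g := fun _ => (1 - 2 * ε)⁻¹)
    (dSmooth_real_sub dSmooth_id' dSmooth_const) dSmooth_const)

/-- Applying `collapse` to every coordinate. -/
def cubeCollapse {n : ℕ} (ε : ℝ) (x : EuclideanSpace ℝ (Fin n)) : EuclideanSpace ℝ (Fin n) :=
  WithLp.toLp 2 fun i => collapse ε (x i)

theorem cubeCollapse_apply {n : ℕ} (ε : ℝ) (x : EuclideanSpace ℝ (Fin n)) (i : Fin n) :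
    cubeCollapse ε x i = collapse ε (x i) := rfl

theorem dSmooth_cubeCollapse {n : ℕ} (ε : ℝ) :
    DSmooth (cubeCollapse ε : EuclideanSpace ℝ (Fin n) → _) :=
  dSmooth_euclidean.2 fun i => (dSmooth_collapse ε).comp' (dSmooth_apply i)

/-- Pairs of a subspace of `ℝ^n` between the unit cube and `ℝ^n`, and a subset between the boundary
of the cube and its `ε`-neighbourhood, given by a condition `c` on the coordinates. -/
structure IsCubical (P : Pair) {n : ℕ} (ε : ℝ) (j : P.carrier → EuclideanSpace ℝ (Fin n))
    (c : ℝ → Prop) : Prop where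
  isInduction : IsInduction j
  exists_eq : ∀ (x : P.carrier) (z : EuclideanSpace ℝ (Fin n)), (∀ i, 0 ≤ z i ∧ z i ≤ 1) →
    ∀ s ∈ Set.Icc (0 : ℝ) 1, ∃ y, j y = (1 - s) • z + s • j x
  exists_eq_of_mem : ∀ z : EuclideanSpace ℝ (Fin n), (∀ i, 0 ≤ z i ∧ z i ≤ 1) → ∃ y, j y = z
  mem_sub : ∀ x, x ∈ P.sub ↔ ∃ i, c (j x i)
  cond_le : ∀ t, c t → t ≤ ε ∨ 1 - ε ≤ t
  cond_zero : ∀ t, c t → t ≤ ε → ∀ s ∈ Set.Icc (0 : ℝ) 1, c (s * t)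
  cond_one : ∀ t, c t → 1 - ε ≤ t → ∀ s ∈ Set.Icc (0 : ℝ) 1, c (1 - s + s * t)

namespace IsCubical

variable {P Q : Pair} {n : ℕ} {ε : ℝ} {j : P.carrier → EuclideanSpace ℝ (Fin n)}
  {k : Q.carrier → EuclideanSpace ℝ (Fin n)} {c d : ℝ → Prop}

/-- Collapsing sends a coordinate within `ε` of the boundary, or beyond it, exactly to `0` or `1`.
Hence the same formula gives a map of pairs whether the subsets are thin or thick. -/
theorem exists_pairMap (hP : IsCubical P ε j c) (hQ : IsCubical Q ε k d) (hε : ε < 1 / 2)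
    (hd : d 0 ∧ d 1) :
    ∃ f : PairMap P.sub Q.sub, ∀ x, k (f.1 x) = cubeCollapse ε (j x) := by
  choose f hf using fun x : P.carrier =>
    hQ.exists_eq_of_mem (cubeCollapse ε (j x)) fun i => collapse_mem ε (j x i)
  refine ⟨⟨⟨f, hQ.isInduction.dSmooth_of_comp ?_⟩, fun x hx => ?_⟩, hf⟩
  · simp only [hf]
    exact (dSmooth_cubeCollapse ε).comp' hP.isInduction.dSmooth
  · obtain ⟨i, hi⟩ := (hP.mem_sub x).1 hx
    refine (hQ.mem_sub _).2 ⟨i, ?_⟩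
    simp only [hf, cubeCollapse_apply]
    rcases hP.cond_le _ hi with h | h
    · rw [collapse_eq_zero hε h]; exact hd.1
    · rw [collapse_eq_one hε h]; exact hd.2

/-- A coordinate `t ≤ ε` has collapsed to `0`, so along the segment back to the identity it is `s *
t`; a coordinate `t ≥ 1 - ε` has collapsed to `1` and becomes `1 - s + s * t`. These are the
expressions that `cond_zero` and `cond_one` control. -/
theorem smoothlyHomotopic_id (hP : IsCubical P ε j c) (hε : ε < 1 / 2) (hε0 : 0 < ε)
    (f : PairMap P.sub P.sub)
    (hf : ∀ x, j (f.1 x) = cubeCollapse ε (cubeCollapse ε (j x))) :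
    SmoothlyHomotopic f (PairMap.id P.sub) := by
  refine smoothlyHomotopic_of_segment hP.isInduction fun x s hs => ?_
  obtain ⟨y, hy⟩ := hP.exists_eq x (j (f.1 x)) (fun i => by
    rw [hf]; exact collapse_mem ε _) s hs
  refine ⟨y, hy, fun hx => ?_⟩
  obtain ⟨i, hi⟩ := (hP.mem_sub x).1 hx
  refine (hP.mem_sub y).2 ⟨i, ?_⟩
  simp only [hy, PiLp.add_apply, PiLp.smul_apply, hf, cubeCollapse_apply, smul_eq_mul]
  rcases hP.cond_le _ hi with h | h
  · rw [collapse_eq_zero hε h, collapse_eq_zero hε hε0.le, mul_zero, zero_add]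
    exact hP.cond_zero _ hi h s hs
  · rw [collapse_eq_one hε h, collapse_eq_one hε (by linarith), mul_one]
    exact hP.cond_one _ hi h s hs

theorem smoothlyHomotopyEquivalent (hP : IsCubical P ε j c) (hQ : IsCubical Q ε k d)
    (hε : ε ∈ Set.Ioo (0 : ℝ) (1 / 2)) (hc : c 0 ∧ c 1) (hd : d 0 ∧ d 1) :
    P.SmoothlyHomotopyEquivalent Q := by
  obtain ⟨f, hf⟩ := exists_pairMap hP hQ hε.2 hd
  obtain ⟨g, hg⟩ := exists_pairMap hQ hP hε.2 hc
  refine ⟨f, g, hQ.smoothlyHomotopic_id hε.2 hε.1 _ fun x => ?_,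
    hP.smoothlyHomotopic_id hε.2 hε.1 _ fun x => ?_⟩
  · rw [← hg, ← hf]; rfl
  · rw [← hf, ← hg]; rfl

end IsCubical

section Cubical

variable {n : ℕ} {ε : ℝ}

theorem cube_segment {t z s : ℝ} (ht : 0 ≤ t ∧ t ≤ 1) (hz : 0 ≤ z ∧ z ≤ 1)
    (hs : s ∈ Set.Icc (0 : ℝ) 1) : 0 ≤ (1 - s) * z + s * t ∧ (1 - s) * z + s * t ≤ 1 := by
  obtain ⟨h0, h1⟩ := hs
  constructor
  · nlinarith [mul_nonneg (sub_nonneg.2 h1) hz.1, mul_nonneg h0 ht.1]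
  · nlinarith [mul_le_mul_of_nonneg_left hz.2 (sub_nonneg.2 h1), mul_le_mul_of_nonneg_left ht.2 h0]

theorem isCubical_euclidean (hε : ε ∈ Set.Ioo (0 : ℝ) (1 / 2)) :
    IsCubical (euclidean n) ε id (fun t => t = 0 ∨ t = 1) where
  isInduction := isInduction_id
  exists_eq x z _ s _ := ⟨_, rfl⟩
  exists_eq_of_mem z _ := ⟨z, rfl⟩
  mem_sub _ := Iff.rfl
  cond_le := by rintro t (rfl | rfl) <;> [left; right] <;> linarith [hε.1]
  cond_zero := by
    rintro t (rfl | rfl) h s - <;> [skip; linarith [hε.1, hε.2]]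
    simp
  cond_one := by
    rintro t (rfl | rfl) h s - <;> [linarith [hε.1, hε.2]; skip]
    simp

theorem isCubical_euclideanThick (hε : ε ∈ Set.Ioo (0 : ℝ) (1 / 2)) :
    IsCubical (euclideanThick n ε) ε id (fun t => t ≤ ε ∨ 1 - ε ≤ t) where
  isInduction := isInduction_id
  exists_eq x z _ s _ := ⟨_, rfl⟩
  exists_eq_of_mem z _ := ⟨z, rfl⟩
  mem_sub _ := Iff.rfl
  cond_le _ h := h
  cond_zero t _ h s hs := Or.inl (by nlinarith [mul_le_mul_of_nonneg_left h hs.1, hs.2, hε.1])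
  cond_one t _ h s hs := Or.inr (by nlinarith [mul_le_mul_of_nonneg_left h hs.1, hs.2, hε.1])

theorem isCubical_cube (hε : ε ∈ Set.Ioo (0 : ℝ) (1 / 2)) :
    IsCubical (cube n) ε Subtype.val (fun t => t = 0 ∨ t = 1) where
  isInduction := isInduction_subtypeVal
  exists_eq x _ hz _ hs := ⟨⟨_, fun i => cube_segment (x.2 i) (hz i) hs⟩, rfl⟩
  exists_eq_of_mem z hz := ⟨⟨z, hz⟩, rfl⟩
  mem_sub _ := Iff.rfl
  cond_le := (isCubical_euclidean (n := n) hε).cond_le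
  cond_zero := (isCubical_euclidean (n := n) hε).cond_zero
  cond_one := (isCubical_euclidean (n := n) hε).cond_one

theorem isCubical_cubeThick (hε : ε ∈ Set.Ioo (0 : ℝ) (1 / 2)) :
    IsCubical (cubeThick n ε) ε Subtype.val (fun t => t ≤ ε ∨ 1 - ε ≤ t) where
  isInduction := isInduction_subtypeVal
  exists_eq x _ hz _ hs := ⟨⟨_, fun i => cube_segment (x.2 i) (hz i) hs⟩, rfl⟩
  exists_eq_of_mem z hz := ⟨⟨z, hz⟩, rfl⟩
  mem_sub _ := Iff.rfl
  cond_le := (isCubical_euclideanThick (n := n) hε).cond_le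
  cond_zero := (isCubical_euclideanThick (n := n) hε).cond_zero
  cond_one := (isCubical_euclideanThick (n := n) hε).cond_one

theorem euclidean_equivalent_euclideanThick (hε : ε ∈ Set.Ioo (0 : ℝ) (1 / 2)) :
    (euclidean n).SmoothlyHomotopyEquivalent (euclideanThick n ε) :=
  (isCubical_euclidean hε).smoothlyHomotopyEquivalent (isCubical_euclideanThick hε) hε (by simp)
    ⟨Or.inl hε.1.le, Or.inr (by linarith [hε.1])⟩

theorem euclidean_equivalent_cube : (euclidean n).SmoothlyHomotopyEquivalent (cube n) :=
  -- Neither pair involves `ε`; any collapsing width in `(0, 1/2)` serves.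
  have hε : (1 / 4 : ℝ) ∈ Set.Ioo (0 : ℝ) (1 / 2) := by norm_num
  (isCubical_euclidean hε).smoothlyHomotopyEquivalent (isCubical_cube hε) hε (by simp) (by simp)

theorem euclidean_equivalent_cubeThick (hε : ε ∈ Set.Ioo (0 : ℝ) (1 / 2)) :
    (euclidean n).SmoothlyHomotopyEquivalent (cubeThick n ε) :=
  (isCubical_euclidean hε).smoothlyHomotopyEquivalent (isCubical_cubeThick hε) hε (by simp)
    ⟨Or.inl hε.1.le, Or.inr (by linarith [hε.1])⟩

end Cubical

/-! ### Complements of star-shaped neighbourhoods of the origin -/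

/-- The pair `(ℝ^n, ℝ^n \ U)`. -/
def outside {n : ℕ} (U : Set (EuclideanSpace ℝ (Fin n))) : Pair where
  carrier := EuclideanSpace ℝ (Fin n)
  sub := Uᶜ

/-- Bounded neighbourhoods of the origin that are star-shaped with respect to the origin. -/
structure IsStarBody {n : ℕ} (U : Set (EuclideanSpace ℝ (Fin n))) : Prop where
  exists_subset : ∃ r > 0, ∀ x : EuclideanSpace ℝ (Fin n), (∀ i, |x i| < r) → x ∈ U
  exists_bound : ∃ R > 0, ∀ x ∈ U, ∀ i, |x i| ≤ R
  smul_notMem : ∀ x ∉ U, ∀ a : ℝ, 1 ≤ a → a • x ∉ U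

section Outside

variable {n : ℕ} {U V : Set (EuclideanSpace ℝ (Fin n))}

/-- A large enough dilation pushes everything outside `U` to the outside of `V`. The factor `R / r +
1` is at least `1`, and it multiplies `r` to `R + r`, strictly beyond the bound `R` of `V`. -/
theorem IsStarBody.exists_pairMap (hU : IsStarBody U) (hV : IsStarBody V) :
    ∃ c : ℝ, 1 ≤ c ∧ ∃ f : PairMap (outside U).sub (outside V).sub,
      ∀ x : EuclideanSpace ℝ (Fin n), f.1 x = (c • x : EuclideanSpace ℝ (Fin n)) := by
  obtain ⟨r, hr, hrU⟩ := hU.exists_subset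
  obtain ⟨R, hR, hRV⟩ := hV.exists_bound
  have hc : 1 ≤ R / r + 1 := by linarith [div_pos hR hr]
  refine ⟨R / r + 1, hc, ⟨⟨fun x : EuclideanSpace ℝ (Fin n) => (R / r + 1) • x,
    dSmooth_smul dSmooth_const dSmooth_id'⟩, fun (x : EuclideanSpace ℝ (Fin n)) hx hxV =>
      hx (hrU _ fun i => ?_)⟩, fun _ => rfl⟩
  have h : |((R / r + 1) • x) i| ≤ R := hRV _ hxV i
  rw [PiLp.smul_apply, smul_eq_mul, abs_mul, abs_of_pos (by linarith)] at h
  by_contra! h'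
  have h1 := mul_le_mul_of_nonneg_left h' (by linarith : 0 ≤ R / r + 1)
  have h2 : (R / r + 1) * r = R + r := by field_simp
  linarith

/-- The segment from `c • x` to `x` consists of multiples of `x` by factors at least `1`, which stay
outside a star-shaped set once `x` does. -/
theorem IsStarBody.smoothlyHomotopic_id (hU : IsStarBody U)
    (f : PairMap (outside U).sub (outside U).sub) {c : ℝ} (hc : 1 ≤ c)
    (hf : ∀ x : EuclideanSpace ℝ (Fin n), f.1 x = (c • x : EuclideanSpace ℝ (Fin n))) :
    SmoothlyHomotopic f (PairMap.id _) := by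
  refine smoothlyHomotopic_of_segment (Y := EuclideanSpace ℝ (Fin n)) isInduction_id
    fun (x : EuclideanSpace ℝ (Fin n)) s hs => ⟨_, rfl, fun hx => ?_⟩
  have h : ∀ y : EuclideanSpace ℝ (Fin n), y = c • x → (1 - s) • y + s • x ∉ U := by
    rintro _ rfl
    rw [← mul_smul, ← add_smul]
    refine hU.smul_notMem x hx _ ?_
    nlinarith [mul_le_mul_of_nonneg_left hc (sub_nonneg.2 hs.2)]
  exact h _ (hf x)

theorem IsStarBody.smoothlyHomotopyEquivalent (hU : IsStarBody U) (hV : IsStarBody V) :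
    (outside U).SmoothlyHomotopyEquivalent (outside V) := by
  obtain ⟨c, hc, f, hf⟩ := hU.exists_pairMap hV
  obtain ⟨d, hd, g, hg⟩ := hV.exists_pairMap hU
  refine ⟨f, g, hV.smoothlyHomotopic_id _ (one_le_mul_of_one_le_of_one_le hc hd) fun x => ?_,
    hU.smoothlyHomotopic_id _ (one_le_mul_of_one_le_of_one_le hd hc) fun x => ?_⟩
  · exact (hf _).trans ((congrArg (fun z : EuclideanSpace ℝ (Fin n) => c • z) (hg x)).trans (mul_smul c d x).symm)
  · exact (hg _).trans ((congrArg (fun z : EuclideanSpace ℝ (Fin n) => d • z) (hf x)).trans (mul_smul d c x).symm)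

theorem isStarBody_closedBall {r : ℝ} (hr : 0 < r) :
    IsStarBody {x : EuclideanSpace ℝ (Fin n) | ‖x‖ ≤ r} where
  exists_subset := by
    -- With all coordinates below `r / (n + 1)`, the squared norm is at most `r ^ 2 * n / (n + 1) ^
    -- 2`. Using `n + 1` also covers `n = 0`.
    refine ⟨r / (n + 1), by positivity, fun x hx => ?_⟩
    refine abs_le_of_sq_le_sq' ?_ hr.le |>.2
    rw [EuclideanSpace.norm_sq_eq]
    calc ∑ i, ‖x i‖ ^ 2 ≤ ∑ _i : Fin n, (r / (n + 1)) ^ 2 :=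
          Finset.sum_le_sum fun i _ => by
            have := (hx i).le
            rw [← Real.norm_eq_abs] at this
            gcongr
      _ = r ^ 2 * (n / (n + 1) ^ 2) := by
          simp [div_pow]
          ring
      _ ≤ r ^ 2 * 1 := by
          gcongr
          rw [div_le_one (by positivity)]
          nlinarith [Nat.cast_nonneg (α := ℝ) n]
      _ = r ^ 2 := mul_one _
  exists_bound := ⟨r, hr, fun x hx i => (PiLp.norm_apply_le x i).trans hx⟩
  smul_notMem x hx a ha h := hx (by
    simp only [Set.mem_ofPred_eq, norm_smul, Real.norm_eq_abs] at h ⊢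
    rw [abs_of_pos (by linarith)] at h
    nlinarith [norm_nonneg x])

theorem isStarBody_box {r : ℝ} (hr : 0 < r) :
    IsStarBody {x : EuclideanSpace ℝ (Fin n) | ∀ i, |x i| < r} where
  exists_subset := ⟨r, hr, fun _ h => h⟩
  exists_bound := ⟨r, hr, fun x hx i => (hx i).le⟩
  smul_notMem x hx a ha h := hx fun i => by
    have := h i
    rw [PiLp.smul_apply, smul_eq_mul, abs_mul, abs_of_pos (by linarith)] at this
    nlinarith [abs_nonneg (x i)]

/-- Translation by the centre of the cube turns `x i ≤ ε ∨ 1 - ε ≤ x i` into `1 / 2 - ε ≤ |x i|`. -/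
theorem euclideanThick_equivalent_outside (ε : ℝ) :
    (euclideanThick n ε).SmoothlyHomotopyEquivalent
      (outside {x : EuclideanSpace ℝ (Fin n) | ∀ i, |x i| < 1 / 2 - ε}) := by
  let a : EuclideanSpace ℝ (Fin n) := WithLp.toLp 2 fun _ => 1 / 2
  refine smoothlyHomotopyEquivalent_of_inverse
    ⟨⟨fun x : EuclideanSpace ℝ (Fin n) => x - a, dSmooth_sub dSmooth_id' dSmooth_const⟩, ?_⟩
    ⟨⟨fun x : EuclideanSpace ℝ (Fin n) => x + a, dSmooth_add dSmooth_id' dSmooth_const⟩, ?_⟩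
    (fun x => add_sub_cancel_right (G := EuclideanSpace ℝ (Fin n)) x a)
    (fun x => sub_add_cancel (G := EuclideanSpace ℝ (Fin n)) x a)
  · rintro (x : EuclideanSpace ℝ (Fin n)) ⟨i, hi⟩ h
    have := abs_lt.1 (h i)
    have ha : (x - a) i = x i - 1 / 2 := rfl
    rw [ha] at this
    rcases hi with hi | hi <;> linarith [this.1, this.2]
  · rintro (x : EuclideanSpace ℝ (Fin n)) hx
    obtain ⟨i, hi⟩ := not_forall.1 hx
    rw [not_lt] at hi
    have ha : (x + a) i = x i + 1 / 2 := rfl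
    refine ⟨i, ?_⟩
    change (x + a) i ≤ ε ∨ 1 - ε ≤ (x + a) i
    rw [ha]
    rcases le_abs.1 hi with h | h
    · right; linarith
    · left; linarith

theorem euclidean_equivalent_outside (hU : IsStarBody U) :
    (euclidean n).SmoothlyHomotopyEquivalent (outside U) :=
  (euclidean_equivalent_euclideanThick (ε := 1 / 4) (by norm_num)).trans
    ((euclideanThick_equivalent_outside _).trans
      ((isStarBody_box (by norm_num)).smoothlyHomotopyEquivalent hU))

end Outside

end Pair

namespace Pair

/-! ### Disks -/

section Disk

variable {n : ℕ}

/-- There is a smooth map from Euclidean space to the unit disk which is the radial projection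
to the unit sphere outside a disk of radius less than one. -/
theorem exists_diskCollapse {ι : Type*} [Fintype ι] {ρ : ℝ} (hρ : ρ ∈ Set.Ioo (0 : ℝ) 1) :
    ∃ φ : EuclideanSpace ℝ ι → EuclideanSpace ℝ ι, DSmooth φ ∧ (∀ x, ‖φ x‖ ≤ 1) ∧
      ∀ x, ρ < ‖x‖ → φ x = ‖x‖⁻¹ • x := by
  obtain ⟨h0, h1⟩ := hρ
  -- The map will be `x / √(D (‖x‖ ^ 2))`. Here `D` interpolates between `1` at `q = 0` and `q` for
  -- `q ≥ ρ ^ 2`. It is positive, so the quotient is smooth at the origin, and `q ≤ D q`, so the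
  -- image lies in the disk. The squared norm is used because it is smooth everywhere.
  let τ : ℝ → ℝ := fun q => Real.smoothTransition (1 - q * (ρ ^ 2)⁻¹)
  let D : ℝ → ℝ := fun q => q + (1 - q) * τ q
  have hτ : ∀ q, 0 ≤ τ q := fun q => Real.smoothTransition.nonneg _
  have hτ0 : ∀ q, ρ ^ 2 ≤ q → τ q = 0 := fun q hq => by
    refine Real.smoothTransition.zero_of_nonpos ?_
    rw [← div_eq_mul_inv, sub_nonpos, one_le_div (by positivity)]
    exact hq
  have hD : ∀ q, ρ ^ 2 ≤ q → D q = q := fun q hq => by simp [D, hτ0 q hq]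
  have hle : ∀ q, q ≤ D q := fun q => by
    rcases le_total q 1 with h | h
    · exact le_add_of_nonneg_right (mul_nonneg (sub_nonneg.2 h) (hτ q))
    · exact (hD q (by nlinarith)).ge
  have hpos : ∀ q, 0 ≤ q → 0 < D q := fun q hq => by
    rcases hq.eq_or_lt with rfl | h
    · simp [D, τ]
    · exact h.trans_le (hle q)
  have hsq : ∀ x : EuclideanSpace ℝ ι, ‖x‖ ≤ √(D (‖x‖ ^ 2)) := fun x =>
    Real.le_sqrt_of_sq_le (hle _)
  have hsqpos : ∀ x : EuclideanSpace ℝ ι, 0 < √(D (‖x‖ ^ 2)) := fun x =>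
    Real.sqrt_pos.2 (hpos _ (sq_nonneg _))
  refine ⟨fun x => (√(D (‖x‖ ^ 2)))⁻¹ • x, ?_, fun x => ?_, fun x hx => ?_⟩
  · have hq : DSmooth (fun x : EuclideanSpace ℝ ι => ‖x‖ ^ 2) := dSmooth_norm_sq dSmooth_id'
    refine dSmooth_smul (dSmooth_real_inv (dSmooth_real_sqrt (dSmooth_real_add hq
      (dSmooth_real_mul (dSmooth_real_sub dSmooth_const hq) (dSmooth_smoothTransition
        (dSmooth_real_sub dSmooth_const (dSmooth_real_mul hq dSmooth_const))))) ?_) ?_) dSmooth_id'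
    · exact fun x => (hpos _ (sq_nonneg ‖x‖)).ne'
    · exact fun x => (hsqpos x).ne'
  · rw [norm_smul, norm_inv, Real.norm_of_nonneg (hsqpos x).le, inv_mul_le_one₀ (hsqpos x)]
    exact hsq x
  · change (√(D (‖x‖ ^ 2)))⁻¹ • x = _
    rw [hD _ (by gcongr), Real.sqrt_sq (norm_nonneg x)]

/-- The pair of the unit disk and the subset given by the condition `c` on the norm. -/
def diskPair (n : ℕ) (c : ℝ → Prop) : Pair where
  carrier := Disk n
  sub := {x | c ‖x.1‖}

theorem norm_segment_radial {ι : Type*} [Fintype ι] {x : EuclideanSpace ℝ ι} (hx : 0 < ‖x‖) {s : ℝ}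
    (hs : s ∈ Set.Icc (0 : ℝ) 1) : ‖(1 - s) • ‖x‖⁻¹ • x + s • x‖ = (1 - s) + s * ‖x‖ := by
  have h : 0 ≤ (1 - s) * ‖x‖⁻¹ + s :=
    add_nonneg (mul_nonneg (sub_nonneg.2 hs.2) (inv_nonneg.2 hx.le)) hs.1
  rw [← mul_smul, ← add_smul, norm_smul, Real.norm_of_nonneg h, add_mul, mul_assoc,
    inv_mul_cancel₀ hx.ne', mul_one]

/-- The equivalence is the inclusion, with the radial collapse as homotopy inverse. Where `ρ < ‖x‖`,
the segment from `‖x‖⁻¹ • x` to `x` is radial and its norm runs between `1` and `‖x‖`. It therefore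
stays above `ρ`, and inside the disk it never drops below `‖x‖`, which is what `hmono` needs. -/
theorem diskPair_equivalent_outside {ρ : ℝ} (hρ : ρ ∈ Set.Ioo (0 : ℝ) 1) {c : ℝ → Prop}
    (h1 : c 1) (hc : ∀ t, c t → ρ < t) (hmono : ∀ t, c t → ∀ t', t ≤ t' → t' ≤ 1 → c t') :
    (diskPair n c).SmoothlyHomotopyEquivalent
      (outside {x : EuclideanSpace ℝ (Fin n) | ‖x‖ ≤ ρ}) := by
  obtain ⟨φ, hφ, hle, heq⟩ := exists_diskCollapse (ι := Fin n) hρ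
  have hpos : ∀ x : EuclideanSpace ℝ (Fin n), ρ < ‖x‖ → 0 < ‖x‖ := fun x hx => hρ.1.trans hx
  refine ⟨⟨⟨fun x : Disk n => x.1, dSmooth_subtypeVal⟩, fun x hx => not_le.2 (hc _ hx)⟩,
    ⟨⟨fun x : EuclideanSpace ℝ (Fin n) => (⟨φ x, hle x⟩ : Disk n), hφ⟩, ?_⟩, ?_, ?_⟩
  · intro (x : EuclideanSpace ℝ (Fin n)) hx
    have hx' : ρ < ‖x‖ := not_le.1 hx
    change c ‖φ x‖
    rw [heq x hx', norm_smul, norm_inv, norm_norm, inv_mul_cancel₀ (hpos x hx').ne']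
    exact h1
  · refine smoothlyHomotopic_of_segment (Y := EuclideanSpace ℝ (Fin n)) isInduction_id
      fun (x : EuclideanSpace ℝ (Fin n)) s hs => ⟨_, rfl, fun hx => ?_⟩
    have hx' : ρ < ‖x‖ := not_le.1 hx
    change ¬‖(1 - s) • φ x + s • x‖ ≤ ρ
    rw [not_le, heq x hx', norm_segment_radial (hpos x hx') hs]
    -- At `s = 0` the norm is `1` and strictness comes from `ρ < 1`; for `s > 0` it comes from `ρ <
    -- ‖x‖`.
    rcases hs.1.eq_or_lt with rfl | h
    · linarith [hρ.2]
    · nlinarith [mul_lt_mul_of_pos_left hx' h, hρ.2, hs.2]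
  · refine smoothlyHomotopic_of_segment (Y := Disk n) isInduction_subtypeVal
      fun (x : Disk n) s hs => ⟨⟨(1 - s) • φ x.1 + s • x.1, ?_⟩, rfl, fun hx => ?_⟩
    · refine (norm_add_le _ _).trans ?_
      rw [norm_smul, norm_smul, Real.norm_of_nonneg hs.1, Real.norm_of_nonneg (sub_nonneg.2 hs.2)]
      nlinarith [mul_le_mul_of_nonneg_left (hle x.1) (sub_nonneg.2 hs.2),
        mul_le_mul_of_nonneg_left x.2 hs.1]
    · have hx' : ρ < ‖x.1‖ := hc _ hx
      change c ‖(1 - s) • φ x.1 + s • x.1‖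
      rw [heq x.1 hx', norm_segment_radial (hpos _ hx') hs]
      refine hmono _ hx _ ?_ ?_
      · nlinarith [mul_nonneg (sub_nonneg.2 hs.2) (sub_nonneg.2 x.2)]
      · nlinarith [mul_le_mul_of_nonneg_left x.2 hs.1]

theorem euclidean_equivalent_disk : (euclidean n).SmoothlyHomotopyEquivalent (disk n) :=
  (euclidean_equivalent_outside (isStarBody_closedBall one_half_pos)).trans
    (diskPair_equivalent_outside (c := fun t => t = 1) (by norm_num) rfl
      (by rintro _ rfl; norm_num) (by rintro _ rfl t' h h'; exact le_antisymm h' h)).symm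

theorem euclidean_equivalent_diskThick {ε : ℝ} (hε : ε ∈ Set.Ioo (0 : ℝ) (1 / 2)) :
    (euclidean n).SmoothlyHomotopyEquivalent (diskThick n ε) :=
  (euclidean_equivalent_outside (isStarBody_closedBall (r := 1 - ε) (by linarith [hε.2]))).trans
    (diskPair_equivalent_outside (c := fun t => 1 - ε < t)
      ⟨by linarith [hε.2], by linarith [hε.1]⟩ (by linarith [hε.1]) (fun _ h => h)
      (fun _ h _ h' _ => h.trans_le h')).symm

end Disk

/-! ### Simplices -/

section Simplex

variable {n : ℕ} {ε : ℝ}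

/-- Cut each coordinate off smoothly below `ε` and renormalise the sum to `1`. The sum cannot
vanish: the `n + 1` coordinates add up to `1` and `(n + 1) * ε < 1`, so one of them exceeds `ε`. -/
theorem exists_simplexCollapse (hε : ε ∈ Set.Ioo (0 : ℝ) (1 / ((n : ℝ) + 1))) :
    ∃ φ : Simplex n → Simplex n, DSmooth φ ∧ ∀ x i, x.1 i ≤ ε → (φ x).1 i = 0 := by
  let μ : ℝ → ℝ := fun t => Real.smoothTransition (t - ε)
  have hμ : ∀ t, 0 ≤ μ t := fun t => Real.smoothTransition.nonneg _
  have hpos : ∀ x : Simplex n, 0 < ∑ i, μ (x.1 i) := fun x => by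
    obtain ⟨i, hi⟩ : ∃ i, ε < x.1 i := by
      by_contra! h
      have h1 : ∑ i, x.1 i ≤ ∑ _i : Fin (n + 1), ε := Finset.sum_le_sum fun i _ => h i
      rw [x.2, Finset.sum_const, Finset.card_univ, Fintype.card_fin, nsmul_eq_mul] at h1
      have h2 := (lt_div_iff₀ (by positivity)).1 hε.2
      push_cast at h1
      linarith
    exact Finset.sum_pos' (fun i _ => hμ _)
      ⟨i, Finset.mem_univ i, Real.smoothTransition.pos_of_pos (sub_pos.2 hi)⟩
  have hs : ∀ i, DSmooth (fun x : Simplex n => μ (x.1 i)) := fun i => dSmooth_smoothTransition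
    (dSmooth_real_sub ((dSmooth_apply i).comp' dSmooth_subtypeVal) dSmooth_const)
  refine ⟨fun x => ⟨WithLp.toLp 2 fun i => μ (x.1 i) / ∑ k, μ (x.1 k), ?_⟩, ?_, fun x i hi => ?_⟩
  · change ∑ i, μ (x.1 i) / ∑ k, μ (x.1 k) = 1
    rw [← Finset.sum_div, div_self (hpos x).ne']
  · exact dSmooth_subtypeMk (dSmooth_euclidean.2 fun i =>
      dSmooth_real_div (hs i) (dSmooth_real_sum hs) fun x => (hpos x).ne') _
  · change μ (x.1 i) / _ = 0
    rw [show μ (x.1 i) = 0 from Real.smoothTransition.zero_of_nonpos (sub_nonpos.2 hi), zero_div]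

/-- The identity and the collapse are homotopy inverse. A coordinate that is at most `ε` collapses
to `0`, so on the segment it is `s` times its original value, hence still at most `ε`, and still `0`
if it was `0`. -/
theorem simplex_equivalent_simplexThick (hε : ε ∈ Set.Ioo (0 : ℝ) (1 / ((n : ℝ) + 1))) :
    (simplex n).SmoothlyHomotopyEquivalent (simplexThick n ε) := by
  obtain ⟨φ, hφ, h0⟩ := exists_simplexCollapse hε
  have hsum : ∀ (x y : Simplex n) (s : ℝ), ∑ i, ((1 - s) • x.1 + s • y.1) i = 1 := fun x y s => by
    simp only [PiLp.add_apply, PiLp.smul_apply, smul_eq_mul, Finset.sum_add_distrib,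
      ← Finset.mul_sum, x.2, y.2]
    ring
  refine ⟨⟨⟨fun x => x, dSmooth_id'⟩, ?_⟩, ⟨⟨φ, hφ⟩, ?_⟩, ?_, ?_⟩
  · rintro x ⟨i, hi⟩
    exact ⟨i, hi.le.trans hε.1.le⟩
  · rintro x ⟨i, hi⟩
    exact ⟨i, h0 x i hi⟩
  · refine smoothlyHomotopic_of_segment (Y := Simplex n) isInduction_subtypeVal
      fun (x : Simplex n) s hs => ⟨⟨(1 - s) • (φ x).1 + s • x.1, hsum _ _ _⟩, rfl, ?_⟩
    rintro ⟨i, hi⟩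
    refine ⟨i, ?_⟩
    have hi' : x.1 i ≤ ε := hi
    simp only [PiLp.add_apply, PiLp.smul_apply, smul_eq_mul, h0 x i hi', mul_zero, zero_add]
    nlinarith [mul_le_mul_of_nonneg_left hi' hs.1, hs.2, hε.1]
  · refine smoothlyHomotopic_of_segment (Y := Simplex n) isInduction_subtypeVal
      fun (x : Simplex n) s hs => ⟨⟨(1 - s) • (φ x).1 + s • x.1, hsum _ _ _⟩, rfl, ?_⟩
    rintro ⟨i, hi⟩
    refine ⟨i, ?_⟩
    have hi' : x.1 i = 0 := hi
    simp only [PiLp.add_apply, PiLp.smul_apply, smul_eq_mul, h0 x i (hi'.le.trans hε.1.le), hi',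
      mul_zero, zero_add]

/-- The simplex of size `δ` around the origin of `ℝ^n`. -/
def openSimplex (n : ℕ) (δ : ℝ) : Set (EuclideanSpace ℝ (Fin n)) :=
  {x | (∀ i, -δ < x i) ∧ ∑ i, x i < δ}

theorem isStarBody_openSimplex {δ : ℝ} (hδ : 0 < δ) : IsStarBody (openSimplex n δ) where
  exists_subset := by
    refine ⟨δ / (n + 1), by positivity, fun x hx => ⟨fun i => ?_, ?_⟩⟩
    · have h : δ / (n + 1) ≤ δ := div_le_self hδ.le (by linarith [Nat.cast_nonneg (α := ℝ) n])
      linarith [(abs_lt.1 (hx i)).1]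
    · calc ∑ i, x i ≤ ∑ _i : Fin n, δ / (n + 1) :=
            Finset.sum_le_sum fun i _ => (abs_lt.1 (hx i)).2.le
        _ = n * (δ / (n + 1)) := by simp
        _ < (n + 1) * (δ / (n + 1)) := by
          have : 0 < δ / (n + 1) := by positivity
          linarith
        _ = δ := by field_simp
  exists_bound := by
    refine ⟨(n + 1) * δ, by positivity, fun x ⟨h1, h2⟩ i => abs_le.2 ⟨?_, ?_⟩⟩
    · nlinarith [h1 i, mul_nonneg (Nat.cast_nonneg (α := ℝ) n) hδ.le]
    · have h : x i + δ ≤ ∑ k, (x k + δ) :=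
        Finset.single_le_sum (f := fun k => x k + δ) (fun k _ => by linarith [h1 k])
          (Finset.mem_univ i)
      rw [Finset.sum_add_distrib, Finset.sum_const, Finset.card_univ, Fintype.card_fin,
        nsmul_eq_mul] at h
      linarith
  smul_notMem x hx a ha h := by
    have ha0 : 0 < a := by linarith
    refine hx ⟨fun i => ?_, ?_⟩
    · have h1 : -δ < a * x i := h.1 i
      by_contra! h'
      nlinarith [mul_le_mul_of_nonneg_left h' ha0.le]
    · have h1 : ∑ i, a * x i < δ := h.2
      rw [← Finset.mul_sum] at h1
      by_contra! h'
      nlinarith [mul_le_mul_of_nonneg_left h' ha0.le]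

/-- Dropping `x 0` and moving the barycentre to the origin identifies the simplex with `ℝ^n`. The
new coordinates sum to `b - x 0`, where `b = 1 / (n + 1)`, so `ε < x 0` becomes the bound on the sum
in `openSimplex`, and `ε < x i.succ` becomes the bound on a single coordinate. -/
theorem simplexThick_equivalent_outside (n : ℕ) (ε : ℝ) :
    (simplexThick n ε).SmoothlyHomotopyEquivalent
      (outside (openSimplex n (1 / ((n : ℝ) + 1) - ε))) := by
  let b : ℝ := 1 / ((n : ℝ) + 1)
  have hb : ((n : ℝ) + 1) * b = 1 := mul_one_div_cancel (by positivity)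
  let a : EuclideanSpace ℝ (Fin n) := WithLp.toLp 2 fun _ => b
  have hsum : ∀ x : Simplex n, ∑ i : Fin n, x.1 i.succ = 1 - x.1 0 := fun x => by
    have := x.2
    rw [Fin.sum_univ_succ] at this
    linarith
  have hsum' : ∀ x : Simplex n, ∑ i : Fin n, (euclideanTail x.1 - a) i = b - x.1 0 := fun x => by
    have h : ∀ i : Fin n, (euclideanTail x.1 - a) i = x.1 i.succ - b := fun _ => rfl
    simp only [h, Finset.sum_sub_distrib, hsum, Finset.sum_const, Finset.card_univ,
      Fintype.card_fin, nsmul_eq_mul]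
    linarith
  refine smoothlyHomotopyEquivalent_of_inverse
    ⟨⟨fun x : Simplex n => euclideanTail x.1 - a, dSmooth_sub
      (dSmooth_euclideanTail.comp' dSmooth_subtypeVal) dSmooth_const⟩, ?_⟩
    ⟨⟨fun y : EuclideanSpace ℝ (Fin n) =>
      (⟨euclideanCons (b - ∑ i, y i) (y + a), ?_⟩ : Simplex n), ?_⟩, ?_⟩ ?_ ?_
  · rintro x ⟨i, hi⟩ ⟨h1, h2⟩
    have hi' : x.1 i ≤ ε := hi
    induction i using Fin.cases with
    | zero =>
      have h3 := (hsum' x).symm.trans_lt h2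
      change b - x.1 0 < b - ε at h3
      linarith
    | succ i =>
      have h3 : -(b - ε) < x.1 i.succ - b := h1 i
      linarith
  · have h : ∀ i, (y + a) i = y i + b := fun _ => rfl
    simp only [Fin.sum_univ_succ, euclideanCons_zero, euclideanCons_succ, h,
      Finset.sum_add_distrib, Finset.sum_const, Finset.card_univ, Fintype.card_fin, nsmul_eq_mul]
    linarith
  · exact dSmooth_subtypeMk (dSmooth_euclideanCons.comp' (dSmooth_prodMk
      (dSmooth_real_sub dSmooth_const (dSmooth_real_sum dSmooth_apply))
      (dSmooth_add dSmooth_id' dSmooth_const))) _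
  · intro (y : EuclideanSpace ℝ (Fin n)) hy
    by_contra h
    have h' : ∀ i : Fin (n + 1), ε < euclideanCons (b - ∑ i, y i) (y + a) i := fun i =>
      not_le.1 fun hi => h ⟨i, hi⟩
    refine hy ⟨fun i => ?_, ?_⟩
    · have h1 : ε < y i + b := h' i.succ
      change -(b - ε) < y i
      linarith
    · have h1 : ε < b - ∑ i, y i := h' 0
      change ∑ i, y i < b - ε
      linarith
  · exact fun x => add_sub_cancel_right (G := EuclideanSpace ℝ (Fin n)) x a
  · intro (x : Simplex n)
    refine Subtype.ext ?_
    change euclideanCons (b - ∑ i, (euclideanTail x.1 - a) i) (euclideanTail x.1 - a + a) = x.1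
    rw [hsum', sub_add_cancel, sub_sub_cancel, euclideanCons_tail]

theorem euclidean_equivalent_simplexThick (hε : ε ∈ Set.Ioo (0 : ℝ) (1 / ((n : ℝ) + 1))) :
    (euclidean n).SmoothlyHomotopyEquivalent (simplexThick n ε) :=
  (euclidean_equivalent_outside (isStarBody_openSimplex (sub_pos.2 hε.2))).trans
    (simplexThick_equivalent_outside n ε).symm

theorem euclidean_equivalent_simplex : (euclidean n).SmoothlyHomotopyEquivalent (simplex n) := by
  have h : (0 : ℝ) < 1 / ((n : ℝ) + 1) := by positivity
  have hε := Set.mem_Ioo.2 ⟨half_pos h, half_lt_self h⟩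
  exact (euclidean_equivalent_simplexThick hε).trans (simplex_equivalent_simplexThick hε).symm

end Simplex

end Pair

/-! ### Spheres: thickening the pole and projecting stereographically. -/

theorem dSmooth_norm {X ι : Type*} [DiffeologicalSpace X] [Fintype ι]
    {v : X → EuclideanSpace ℝ ι} (hv : DSmooth v) (h : ∀ x, v x ≠ 0) : DSmooth (fun x => ‖v x‖) :=
  fun n p hp => ((hv n p hp).contDiff.norm ℝ fun u => h (p u)).isPlot

namespace Pair

section Sphere

variable {n : ℕ}

/-- The unit sphere in `ℝ^(n+1)`. -/
abbrev Sphere (n : ℕ) : Type := {x : EuclideanSpace ℝ (Fin (n + 1)) // ‖x‖ = 1}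

/-- The north pole `(0, …, 0, 1)`, as a vector in `ℝ^(n+1)`. -/
def northPole (n : ℕ) : EuclideanSpace ℝ (Fin (n + 1)) := EuclideanSpace.single (Fin.last n) 1

theorem northPole_last : northPole n (Fin.last n) = 1 := by simp [northPole]

theorem norm_northPole : ‖northPole n‖ = 1 := by simp [northPole]

/-- The sphere together with the polar cap `x_n > 1/2`. -/
def sphereThick (n : ℕ) : Pair where
  carrier := Sphere n
  sub := {x | 1 / 2 < x.1 (Fin.last n)}

theorem dSmooth_sphere_last : DSmooth (fun x : Sphere n => x.1 (Fin.last n)) :=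
  (dSmooth_apply (Fin.last n)).comp' dSmooth_subtypeVal

/-! #### Contracting a polar cap to the north pole -/

/-- The fraction by which the deformation at time `s` moves a point at height `z`. -/
def capWeight (s z : ℝ) : ℝ := Real.smoothTransition s * Real.smoothTransition (2 * z)

theorem capWeight_mem (s z : ℝ) : capWeight s z ∈ Set.Icc (0 : ℝ) 1 :=
  ⟨mul_nonneg (Real.smoothTransition.nonneg _) (Real.smoothTransition.nonneg _),
    mul_le_one₀ (Real.smoothTransition.le_one _) (Real.smoothTransition.nonneg _)
      (Real.smoothTransition.le_one _)⟩

/-- Shrinking the first `n` coordinates of points in the upper half sphere. -/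
def capShrink (s : ℝ) (x : EuclideanSpace ℝ (Fin (n + 1))) : EuclideanSpace ℝ (Fin (n + 1)) :=
  (1 - capWeight s (x (Fin.last n))) • x +
    (capWeight s (x (Fin.last n)) * x (Fin.last n)) • northPole n

theorem capShrink_last (s : ℝ) (x : EuclideanSpace ℝ (Fin (n + 1))) :
    capShrink s x (Fin.last n) = x (Fin.last n) := by
  simp only [capShrink, PiLp.add_apply, PiLp.smul_apply, smul_eq_mul, northPole_last]
  ring

/-- Shrinking keeps the height, so a zero could only occur on the equator; there the weight vanishes
and the point has not moved. -/
theorem capShrink_ne_zero (s : ℝ) (x : Sphere n) : capShrink s x.1 ≠ 0 := by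
  intro h
  have h1 : x.1 (Fin.last n) = 0 := by
    rw [← capShrink_last s, h]; rfl
  have h2 : x.1 = 0 := by
    rw [← h, capShrink, h1]
    simp [capWeight]
  have h3 := x.2
  rw [h2, norm_zero] at h3
  exact zero_ne_one h3

theorem norm_capShrink_le (s : ℝ) (x : Sphere n) : ‖capShrink s x.1‖ ≤ 1 := by
  obtain ⟨h0, h1⟩ := capWeight_mem s (x.1 (Fin.last n))
  have hz : ‖x.1 (Fin.last n)‖ ≤ 1 := (PiLp.norm_apply_le x.1 _).trans_eq x.2
  refine (norm_add_le _ _).trans ?_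
  rw [norm_smul, norm_smul, x.2, norm_northPole, norm_mul, Real.norm_of_nonneg h0,
    Real.norm_of_nonneg (sub_nonneg.2 h1)]
  nlinarith [mul_le_mul_of_nonneg_left hz h0]

/-- The deformation of the sphere pulling the upper half sphere towards the north pole. -/
def capDeform (s : ℝ) (x : Sphere n) : Sphere n :=
  ⟨‖capShrink s x.1‖⁻¹ • capShrink s x.1, norm_smul_inv_norm (capShrink_ne_zero s x)⟩

theorem dSmooth_capDeform : DSmooth (fun z : ℝ × Sphere n => capDeform z.1 z.2) := by
  have hx : DSmooth (fun z : ℝ × Sphere n => z.2.1) := dSmooth_subtypeVal.comp' dSmooth_snd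
  have hl : DSmooth (fun z : ℝ × Sphere n => z.2.1 (Fin.last n)) :=
    dSmooth_sphere_last.comp' dSmooth_snd
  have hw : DSmooth (fun z : ℝ × Sphere n => capWeight z.1 (z.2.1 (Fin.last n))) :=
    dSmooth_real_mul (dSmooth_smoothTransition dSmooth_fst)
      (dSmooth_smoothTransition (dSmooth_real_mul dSmooth_const hl))
  have hv : DSmooth (fun z : ℝ × Sphere n => capShrink z.1 z.2.1) :=
    dSmooth_add (dSmooth_smul (dSmooth_real_sub dSmooth_const hw) hx)
      (dSmooth_smul (dSmooth_real_mul hw hl) dSmooth_const)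
  have h0 : ∀ z : ℝ × Sphere n, capShrink z.1 z.2.1 ≠ 0 := fun z => capShrink_ne_zero _ _
  exact dSmooth_subtypeMk (dSmooth_smul (dSmooth_real_inv (dSmooth_norm hv h0)
    fun z => norm_ne_zero_iff.2 (h0 z)) hv) _

theorem capDeform_zero (x : Sphere n) : capDeform 0 x = x := by
  have h : capShrink 0 x.1 = x.1 := by simp [capShrink, capWeight]
  refine Subtype.ext ?_
  change ‖capShrink 0 x.1‖⁻¹ • capShrink 0 x.1 = x.1
  rw [h, x.2, inv_one, one_smul]

theorem mapsTo_capDeform_sphere (s : ℝ) :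
    Set.MapsTo (capDeform s) (sphere n).sub (sphere n).sub := by
  intro (x : Sphere n) hx
  have hx' : x.1 = northPole n := hx
  have h : capShrink s x.1 = northPole n := by
    rw [capShrink, hx', northPole_last, ← add_smul]
    simp
  change ‖capShrink s x.1‖⁻¹ • capShrink s x.1 = northPole n
  rw [h, norm_northPole, inv_one, one_smul]

/-- Shrinking keeps the height and does not take the norm above `1`, so normalising can only raise a
point of the cap. -/
theorem mapsTo_capDeform_sphereThick (s : ℝ) :
    Set.MapsTo (capDeform s) (sphereThick n).sub (sphereThick n).sub := by
  intro (x : Sphere n) (hx : 1 / 2 < x.1 (Fin.last n))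
  change 1 / 2 < ‖capShrink s x.1‖⁻¹ * capShrink s x.1 (Fin.last n)
  rw [capShrink_last]
  have h := (one_le_inv₀ (norm_pos_iff.2 (capShrink_ne_zero s x))).2 (norm_capShrink_le s x)
  nlinarith

theorem mapsTo_capDeform_one : Set.MapsTo (capDeform 1 : Sphere n → Sphere n)
    (sphereThick n).sub (sphere n).sub := by
  intro (x : Sphere n) (hx : 1 / 2 < x.1 (Fin.last n))
  have hw : capWeight 1 (x.1 (Fin.last n)) = 1 := by
    rw [capWeight, Real.smoothTransition.one_of_one_le le_rfl,
      Real.smoothTransition.one_of_one_le (by linarith), one_mul]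
  have h : capShrink 1 x.1 = x.1 (Fin.last n) • northPole n := by
    simp [capShrink, hw]
  have hz : 0 < x.1 (Fin.last n) := by linarith
  change ‖capShrink 1 x.1‖⁻¹ • capShrink 1 x.1 = northPole n
  rw [h, norm_smul, norm_northPole, mul_one, Real.norm_of_nonneg hz.le, smul_smul,
    inv_mul_cancel₀ hz.ne', one_smul]

theorem sphereThick_equivalent_sphere :
    (sphereThick n).SmoothlyHomotopyEquivalent (sphere n) := by
  have h1 : DSmooth (capDeform 1 : Sphere n → Sphere n) :=
    DSmooth.comp' (f := fun x : Sphere n => ((1 : ℝ), x)) (dSmooth_capDeform (n := n))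
      (dSmooth_prodMk dSmooth_const dSmooth_id')
  let f : PairMap (sphereThick n).sub (sphere n).sub :=
    ⟨(⟨capDeform 1, h1⟩ : SmoothMap (Sphere n) (Sphere n)), mapsTo_capDeform_one⟩
  let g : PairMap (sphere n).sub (sphereThick n).sub :=
    ⟨(SmoothMap.id : SmoothMap (Sphere n) (Sphere n)), fun (x : Sphere n) hx => by
      have hx' : x.1 = northPole n := hx
      change 1 / 2 < x.1 (Fin.last n)
      rw [hx', northPole_last]
      norm_num⟩
  -- Both composites are `capDeform 1`, and the same deformation preserves both the pole and the
  -- cap.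
  have h2 : SmoothlyHomotopic (PairMap.id _) (f.comp g) := smoothlyHomotopic_of_dSmooth
    (X := Sphere n) (Y := Sphere n) capDeform dSmooth_capDeform mapsTo_capDeform_sphere
    capDeform_zero fun _ => rfl
  have h3 : SmoothlyHomotopic (PairMap.id _) (g.comp f) := smoothlyHomotopic_of_dSmooth
    (X := Sphere n) (Y := Sphere n) capDeform dSmooth_capDeform mapsTo_capDeform_sphereThick
    capDeform_zero fun _ => rfl
  exact ⟨f, g, PathConnected.symm h2, PathConnected.symm h3⟩

/-! #### Stereographic projection -/

/-- Stereographic projection from the north pole. -/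
def stereo (x : EuclideanSpace ℝ (Fin (n + 1))) : EuclideanSpace ℝ (Fin n) :=
  WithLp.toLp 2 fun i => x i.castSucc / (1 - x (Fin.last n))

/-- The vector underlying the inverse stereographic projection. -/
def invStereoVec (w : EuclideanSpace ℝ (Fin n)) : EuclideanSpace ℝ (Fin (n + 1)) :=
  WithLp.toLp 2 (Fin.snoc (α := fun _ => ℝ) (fun i => 2 * w i / (‖w‖ ^ 2 + 1))
    ((‖w‖ ^ 2 - 1) / (‖w‖ ^ 2 + 1)))

theorem invStereoVec_castSucc (w : EuclideanSpace ℝ (Fin n)) (i : Fin n) :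
    invStereoVec w i.castSucc = 2 * w i / (‖w‖ ^ 2 + 1) :=
  Fin.snoc_castSucc (α := fun _ => ℝ) ((‖w‖ ^ 2 - 1) / (‖w‖ ^ 2 + 1))
    (fun i => 2 * w i / (‖w‖ ^ 2 + 1)) i

theorem invStereoVec_last (w : EuclideanSpace ℝ (Fin n)) :
    invStereoVec w (Fin.last n) = (‖w‖ ^ 2 - 1) / (‖w‖ ^ 2 + 1) :=
  Fin.snoc_last (α := fun _ => ℝ) ((‖w‖ ^ 2 - 1) / (‖w‖ ^ 2 + 1))
    (fun i => 2 * w i / (‖w‖ ^ 2 + 1))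

theorem norm_sq_eq_castSucc (x : EuclideanSpace ℝ (Fin (n + 1))) :
    ‖x‖ ^ 2 = ∑ i : Fin n, x i.castSucc ^ 2 + x (Fin.last n) ^ 2 := by
  simp only [EuclideanSpace.norm_sq_eq, Real.norm_eq_abs, sq_abs, Fin.sum_univ_castSucc]

theorem norm_invStereoVec (w : EuclideanSpace ℝ (Fin n)) : ‖invStereoVec w‖ = 1 := by
  have hq : ∑ i, w i ^ 2 = ‖w‖ ^ 2 := by
    simp only [EuclideanSpace.norm_sq_eq, Real.norm_eq_abs, sq_abs]
  have h : ‖invStereoVec w‖ ^ 2 = 1 := by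
    rw [norm_sq_eq_castSucc]
    simp only [invStereoVec_castSucc, invStereoVec_last, div_pow, mul_pow, ← Finset.sum_div,
      ← Finset.mul_sum, hq]
    field_simp
    ring
  exact (pow_eq_one_iff_of_nonneg (norm_nonneg _) two_ne_zero).1 h

/-- Inverse stereographic projection. -/
def invStereo (w : EuclideanSpace ℝ (Fin n)) : Sphere n := ⟨invStereoVec w, norm_invStereoVec w⟩

theorem dSmooth_invStereo : DSmooth (invStereo : EuclideanSpace ℝ (Fin n) → Sphere n) := by
  have hq : DSmooth (fun w : EuclideanSpace ℝ (Fin n) => ‖w‖ ^ 2) := dSmooth_norm_sq dSmooth_id'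
  have h0 : ∀ w : EuclideanSpace ℝ (Fin n), ‖w‖ ^ 2 + 1 ≠ 0 := fun w => by positivity
  refine dSmooth_subtypeMk (dSmooth_euclidean.2 fun i => ?_) norm_invStereoVec
  induction i using Fin.lastCases with
  | last =>
    simp only [invStereoVec_last]
    exact dSmooth_real_div (dSmooth_real_sub hq dSmooth_const)
      (dSmooth_real_add hq dSmooth_const) h0
  | cast i =>
    simp only [invStereoVec_castSucc]
    exact dSmooth_real_div (dSmooth_real_mul dSmooth_const (dSmooth_apply i))
      (dSmooth_real_add hq dSmooth_const) h0

theorem stereo_invStereo (w : EuclideanSpace ℝ (Fin n)) : stereo (invStereo w).1 = w := by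
  ext i
  change invStereoVec w i.castSucc / (1 - invStereoVec w (Fin.last n)) = w i
  have h0 : ‖w‖ ^ 2 + 1 ≠ 0 := by positivity
  rw [invStereoVec_castSucc, invStereoVec_last, one_sub_div h0]
  field_simp
  ring

theorem invStereo_stereo {x : Sphere n} (hx : x.1 (Fin.last n) < 1) :
    invStereo (stereo x.1) = x := by
  have h1 : 1 - x.1 (Fin.last n) ≠ 0 := (sub_pos.2 hx).ne'
  have hq : ‖stereo x.1‖ ^ 2 = (1 + x.1 (Fin.last n)) / (1 - x.1 (Fin.last n)) := by
    have hx2 := norm_sq_eq_castSucc x.1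
    rw [x.2] at hx2
    have h : ∀ i : Fin n, stereo x.1 i = x.1 i.castSucc / (1 - x.1 (Fin.last n)) := fun _ => rfl
    simp only [EuclideanSpace.norm_sq_eq, Real.norm_eq_abs, sq_abs, h, div_pow, ← Finset.sum_div]
    rw [show ∑ i : Fin n, x.1 i.castSucc ^ 2 = (1 - x.1 (Fin.last n)) * (1 + x.1 (Fin.last n)) by
      linarith]
    field_simp
  have hq1 : ‖stereo x.1‖ ^ 2 + 1 = 2 / (1 - x.1 (Fin.last n)) := by
    rw [hq]
    field_simp
    ring
  refine Subtype.ext (PiLp.ext fun i => ?_)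
  change invStereoVec (stereo x.1) i = x.1 i
  induction i using Fin.lastCases with
  | last =>
    rw [invStereoVec_last, hq1, hq]
    field_simp
    ring
  | cast i =>
    rw [invStereoVec_castSucc, hq1]
    change 2 * (x.1 i.castSucc / (1 - x.1 (Fin.last n))) / _ = _
    field_simp

/-- The disk in `ℝ^n` corresponding to the complement of the polar cap `x_n > 1/2`. -/
def stereoDisk (n : ℕ) : Set (EuclideanSpace ℝ (Fin n)) := {w | ‖w‖ ≤ √3}

/-- The height of `invStereo w` is `(q - 1) / (q + 1)` with `q = ‖w‖ ^ 2`, which exceeds `1 / 2`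
exactly when `q > 3`. -/
theorem notMem_stereoDisk {w : EuclideanSpace ℝ (Fin n)} :
    w ∉ stereoDisk n ↔ 1 / 2 < (invStereo w).1 (Fin.last n) := by
  change ¬‖w‖ ≤ √3 ↔ 1 / 2 < invStereoVec w (Fin.last n)
  rw [not_le, invStereoVec_last, Real.sqrt_lt (by norm_num) (norm_nonneg w),
    lt_div_iff₀ (by positivity)]
  constructor <;> intro h <;> linarith

theorem stereo_notMem_stereoDisk {x : Sphere n} (hx : x.1 (Fin.last n) < 1) :
    stereo x.1 ∉ stereoDisk n ↔ 1 / 2 < x.1 (Fin.last n) := by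
  rw [notMem_stereoDisk, invStereo_stereo hx]

open Classical in
/-- Extending a map on Euclidean space, constant outside a disk, to the sphere. -/
def sphereExtend {Y : Type*} (y : Y) (f : EuclideanSpace ℝ (Fin n) → Y) (x : Sphere n) : Y :=
  if 1 / 2 < x.1 (Fin.last n) then y else f (stereo x.1)

theorem sphereExtend_of_lt {Y : Type*} {y : Y} {f : EuclideanSpace ℝ (Fin n) → Y}
    (hf : ∀ w ∉ stereoDisk n, f w = y) {x : Sphere n} (hx : x.1 (Fin.last n) < 1) :
    sphereExtend y f x = f (stereo x.1) := by
  rw [sphereExtend]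
  split_ifs with h
  · exact (hf _ ((stereo_notMem_stereoDisk hx).2 h)).symm
  · rfl

/-- The open sets `x_n > 1/2` and `x_n < 1` cover the sphere: on the first the extension is
constant, on the second it is the composite with stereographic projection. The parameter space `K`
lets one argument show both that each extension is smooth and that extending is a smooth operation
on maps. -/
theorem dSmooth_sphereExtend {K Y : Type*} [DiffeologicalSpace K] [DiffeologicalSpace Y] {y : Y}
    {F : K → EuclideanSpace ℝ (Fin n) → Y}
    (hF : DSmooth (fun z : K × EuclideanSpace ℝ (Fin n) => F z.1 z.2))
    (hy : ∀ k, ∀ w ∉ stereoDisk n, F k w = y) :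
    DSmooth (fun z : K × Sphere n => sphereExtend y (F z.1) z.2) := by
  have hl : ∀ {m : ℕ} {p : EuclideanSpace ℝ (Fin m) → K × Sphere n}, IsPlot p →
      ContDiff ℝ ∞ (fun u => (p u).2.1 (Fin.last n)) := fun hp =>
    (dSmooth_sphere_last _ _ hp.2).contDiff
  refine dSmooth_of_locally fun z => ?_
  by_cases hz : 1 / 2 < z.2.1 (Fin.last n)
  · refine ⟨{z | 1 / 2 < z.2.1 (Fin.last n)}, fun _ => y, hz,
      fun m p hp => isOpen_Ioi.preimage (hl hp).continuous, fun z hz => if_pos hz,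
      fun _ _ _ _ => isPlot_const⟩
  · refine ⟨{z | z.2.1 (Fin.last n) < 1}, fun z => F z.1 (stereo z.2.1), ?_,
      fun m p hp => isOpen_Iio.preimage (hl hp).continuous,
      fun z hz => sphereExtend_of_lt (hy z.1) hz, fun m p hp hu => ?_⟩
    · change z.2.1 (Fin.last n) < 1
      linarith
    · refine hF m (fun u => ((p u).1, stereo (p u).2.1)) ⟨hp.1, ?_⟩
      refine (contDiff_euclidean.2 fun i => ?_).isPlot
      exact (contDiff_euclidean.1 (IsPlot.contDiff hp.2) i.castSucc).div
        (contDiff_const.sub (hl hp)) fun u => (sub_pos.2 (hu u)).ne'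

/-- Extending maps `(ℝ^n, ℝ^n \ D) → (Y, y)` to the sphere. -/
def sphereExtendMap {Y : Type*} [DiffeologicalSpace Y] (y : Y) :
    SmoothMap (PairMap (outside (stereoDisk n)).sub ({y} : Set Y))
      (PairMap (sphereThick n).sub ({y} : Set Y)) where
  toFun f := ⟨⟨sphereExtend y f.1, (dSmooth_sphereExtend (F := fun _ : ℝ => f.1)
      (f.1.smooth.comp' dSmooth_snd) fun _ _ hw => f.2 hw).comp'
        (dSmooth_prodMk (f := fun _ => 0) dSmooth_const dSmooth_id')⟩, fun _ hx => if_pos hx⟩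
  smooth _ q hq := dSmooth_sphereExtend (F := fun k => (q k).1.toFun) hq fun k _ hw => (q k).2 hw

/-- Inverse stereographic projection as a map of pairs. -/
def invStereoMap (n : ℕ) : PairMap (outside (stereoDisk n)).sub (sphereThick n).sub :=
  ⟨⟨invStereo, dSmooth_invStereo⟩, fun _ hw => notMem_stereoDisk.1 hw⟩

theorem precomp_sphereExtendMap {Y : Type*} [DiffeologicalSpace Y] {y : Y}
    (f : PairMap (outside (stereoDisk n)).sub ({y} : Set Y)) :
    PairMap.precomp {y} (invStereoMap n) (sphereExtendMap y f) = f := by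
  refine Subtype.ext (SmoothMap.ext (funext fun (w : EuclideanSpace ℝ (Fin n)) => ?_))
  change sphereExtend y f.1 (invStereo w) = f.1 w
  unfold sphereExtend
  split_ifs with h
  · exact (f.2 (notMem_stereoDisk.2 h)).symm
  · exact congrArg f.1.toFun (stereo_invStereo w)

theorem sphereExtendMap_precomp {Y : Type*} [DiffeologicalSpace Y] {y : Y}
    (f : PairMap (sphereThick n).sub ({y} : Set Y)) :
    sphereExtendMap y (PairMap.precomp {y} (invStereoMap n) f) = f := by
  refine Subtype.ext (SmoothMap.ext (funext fun (x : Sphere n) => ?_))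
  change sphereExtend y (fun w => f.1 (invStereo w)) x = f.1 x
  unfold sphereExtend
  split_ifs with h
  · exact (f.2 h).symm
  · exact congrArg f.1.toFun (invStereo_stereo (by linarith))

/-- Extension and restriction along `invStereo` are mutually inverse smooth maps between mapping
spaces. The inverse does not come from a map of pairs, so this step uses `of_equiv` rather than a
homotopy equivalence. -/
theorem naturallyBijects_sphere (n : ℕ) : NaturallyBijects.{u} (sphere n) n := by
  have hU : NaturallyBijects.{u} (outside (stereoDisk n)) n :=
    (naturallyBijects_euclidean n).of_smoothlyHomotopyEquivalent
      (euclidean_equivalent_outside (isStarBody_closedBall (by positivity)))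
  have hS : NaturallyBijects.{u} (sphereThick n) n := by
    refine hU.of_equiv (fun X => ⟨PiZero.map (PairMap.precomp {X.pt} (invStereoMap n)),
      PiZero.map (sphereExtendMap X.pt), PiZero.map_leftInverse sphereExtendMap_precomp,
      PiZero.map_leftInverse precomp_sphereExtendMap⟩) ?_
    rintro X Y f ⟨c⟩
    rfl
  exact hS.of_smoothlyHomotopyEquivalent sphereThick_equivalent_sphere

end Sphere

end Pair

end SmoothHomotopy
end

/-! ### Assembling the nine pairs. -/

open SmoothHomotopy
theorem theorem3p1 (n : ℕ) (ε₂ ε₄ ε₆ ε₈ : ℝ)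
    (h₂ : ε₂ ∈ Set.Ioo (0 : ℝ) (1 / 2)) (h₄ : ε₄ ∈ Set.Ioo (0 : ℝ) (1 / 2))
    (h₆ : ε₆ ∈ Set.Ioo (0 : ℝ) (1 / ((n : ℝ) + 1))) (h₈ : ε₈ ∈ Set.Ioo (0 : ℝ) (1 / 2)) :
    (∀ P ∈ [Pair.euclidean n, Pair.euclideanThick n ε₂, Pair.cube n, Pair.cubeThick n ε₄,
        Pair.simplex n, Pair.simplexThick n ε₆, Pair.disk n, Pair.diskThick n ε₈,
        Pair.sphere n],
      Pair.NaturallyBijects.{u} P n) ∧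
    (∀ P ∈ [Pair.euclidean n, Pair.euclideanThick n ε₂, Pair.cube n, Pair.cubeThick n ε₄,
        Pair.simplex n, Pair.simplexThick n ε₆, Pair.disk n, Pair.diskThick n ε₈],
      ∀ Q ∈ [Pair.euclidean n, Pair.euclideanThick n ε₂, Pair.cube n, Pair.cubeThick n ε₄,
        Pair.simplex n, Pair.simplexThick n ε₆, Pair.disk n, Pair.diskThick n ε₈],
      Pair.SmoothlyHomotopyEquivalent P Q) := by
  have key : ∀ P ∈ [Pair.euclidean n, Pair.euclideanThick n ε₂, Pair.cube n, Pair.cubeThick n ε₄,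
      Pair.simplex n, Pair.simplexThick n ε₆, Pair.disk n, Pair.diskThick n ε₈],
      (Pair.euclidean n).SmoothlyHomotopyEquivalent P := by
    simp only [List.forall_mem_cons, List.not_mem_nil, false_imp_iff, implies_true, and_true]
    exact ⟨Pair.SmoothlyHomotopyEquivalent.refl _, Pair.euclidean_equivalent_euclideanThick h₂,
      Pair.euclidean_equivalent_cube, Pair.euclidean_equivalent_cubeThick h₄,
      Pair.euclidean_equivalent_simplex, Pair.euclidean_equivalent_simplexThick h₆,
      Pair.euclidean_equivalent_disk, Pair.euclidean_equivalent_diskThick h₈⟩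
  refine ⟨fun P hP => ?_, fun P hP Q hQ => (key P hP).symm.trans (key Q hQ)⟩
  rcases List.mem_append.1 (show P ∈ [_, _, _, _, _, _, _, _] ++ [Pair.sphere n] from hP) with h | h
  · exact (Pair.naturallyBijects_euclidean n).of_smoothlyHomotopyEquivalent (key P h)
  · rw [List.mem_singleton.1 h]
    exact Pair.naturallyBijects_sphere n
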